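/- For a complex Hilbert space $\mathsf H$ of finite dimension $n>2$, let $\mathsf P(\mathsf H)$ be its projective space, whose points $p=[\psi]$, $\|\psi\|=1$, are identified with the rank-one orthogonal projectors $|\psi\rangle\langle\psi|$, and let $\mu$ be the unique unitarily invariant regular Borel measure on $\mathsf P(\mathsf H)$ with $\mu(\mathsf P(\mathsf H))=n$. A frame is a family $p_1,\dots,p_n\in\mathsf P(\mathsf H)$ of pairwise orthogonal points, i.e. points at pairwise Fubini–Study distance $\pi/2$. A Liouville density on $\mathsf P(\mathsf H)$ is a Borel function $\rho:\mathsf P(\mathsf H)\to[0,1]$ such that $\sum_{i=1}^n\rho(p_i)$ has the same value for all frames and $\int_{\mathsf P(\mathsf H)}\rho\,d\mu=1$. A density matrix is a positive operator $\sigma$ on $\mathsf H$ with $\operatorname{tr}\sigma=1$; $\rho$ describes $\sigma$ if $\rho(p)=\operatorname{tr}(\sigma p)$ for all $p\in\mathsf P(\mathsf H)$. Let $\mathsf H_A$ and $\mathsf H_B$ be complex Hilbert spaces of finite dimension greater than $2$, let $\mathrm{Seg}:\mathsf P(\mathsf H_A)\times\mathsf P(\mathsf H_B)\to\mathsf P(\mathsf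 H_A\otimes\mathsf H_B)$, $([\psi_A],[\psi_B])\mapsto[\psi_A\otimes\psi_B]$, be the Segre embedding, and let $\rho$ be a Liouville density on $\mathsf P(\mathsf H_A\otimes\mathsf H_B)$. (1) $\rho$ describes a separable density matrix, i.e. a finite sum $\sigma=\sum_n\lambda_n\,\sigma_{An}\otimes\sigma_{Bn}$ with $\lambda_n\ge 0$, $\sum_n\lambda_n=1$ and density matrices $\sigma_{An}$ on $\mathsf H_A$ and $\sigma_{Bn}$ on $\mathsf H_B$, if and only if there are finitely many $\lambda_n\ge 0$ with $\sum_n\lambda_n=1$ and Liouville densities $\rho_{An}$ on $\mathsf P(\mathsf H_A)$ and $\rho_{Bn}$ on $\mathsf P(\mathsf H_B)$ such that $$\rho\circ\mathrm{Seg}(p_A,p_B)=\sum_n\lambda_n\,\rho_{An}(p_A)\,\rho_{Bn}(p_B)\qquad\text{for all }(p_A,p_B)\in\mathsf P(\mathsf H_A)\times\mathsf P(\mathsf H_B).$$ (2) $\rho$ describes a product state $\sigma_A\otimes\sigma_B$, with density matrices $\sigma_A$ on $\mathsf H_A$ and $\sigma_B$ on $\mathsf H_B$, if and only if $\rho\circ\mathrm{Seg}(p_A,p_B)=\rho_A(p_A)\,\rho_B(p_B)$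 for all $(p_A,p_B)$, where $\rho_A(p_A)=\int_{\mathsf P(\mathsf H_B)}\rho\circ\mathrm{Seg}(p_A,p_B)\,d\mu_B(p_B)$ and $\rho_B(p_B)=\int_{\mathsf P(\mathsf H_A)}\rho\circ\mathrm{Seg}(p_A,p_B)\,d\mu_A(p_A)$ are the marginals, and $\mu_A$, $\mu_B$ are the above measures on $\mathsf P(\mathsf H_A)$, $\mathsf P(\mathsf H_B)$. -/

import Mathlib

open scoped TensorProduct LinearAlgebra.Projectivization InnerProductSpace
open MeasureTheory Module

noncomputable section

namespace GeometricQM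

/-! ### The projective space of a Hilbert space -/

section Single

variable {H : Type*} [NormedAddCommGroup H] [InnerProductSpace ℂ H]

/-- The projective space `ℙ ℂ H` carries the quotient topology of `H \ {0}`. -/
instance projTopology : TopologicalSpace (ℙ ℂ H) :=
  TopologicalSpace.coinduced (Projectivization.mk' ℂ (V := H)) inferInstance

/-- The projective space carries its Borel σ-algebra. -/
instance projMeasurableSpace : MeasurableSpace (ℙ ℂ H) := borel (ℙ ℂ H)

instance projBorelSpace : BorelSpace (ℙ ℂ H) := ⟨rfl⟩

lemma continuous_mk' : Continuous (Projectivization.mk' ℂ (V := H)) :=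
  continuous_coinduced_rng

/-- The rank-one orthogonal projector `|ψ⟩⟨ψ|`, `‖ψ‖ = 1`, that represents the point `[ψ]`. -/
def projector (p : ℙ ℂ H) : H →ₗ[ℂ] H :=
  (p.submodule.starProjection : H →L[ℂ] H)

/-- On a unit vector `x`, `tr(σ |x⟩⟨x|) = ⟨x|σ x⟩`. -/
lemma trace_comp_projector_mk [FiniteDimensional ℂ H] (σ : H →ₗ[ℂ] H) {x : H} (hx : x ≠ 0)
    (hx1 : ‖x‖ = 1) :
    LinearMap.trace ℂ H (σ ∘ₗ projector (Projectivization.mk ℂ x hx)) = ⟪x, σ x⟫_ℂ := by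
  have h : σ ∘ₗ projector (Projectivization.mk ℂ x hx) =
      (innerSL ℂ x : H →ₗ[ℂ] ℂ).smulRight (σ x) := by
    ext y
    have h1 : projector (Projectivization.mk ℂ x hx) y = ⟪x, y⟫_ℂ • x := by
      simpa [projector] using Submodule.starProjection_unit_singleton ℂ hx1 y
    simp [h1]
  rw [h, LinearMap.trace_smulRight]
  simp

/-- The geodesic distance `d₂` of the Fubini-Study metric, normalised so that orthogonal rays are at
distance `π / 2`: `d₂([ψ], [φ]) = arccos (|⟨ψ|φ⟩| / (‖ψ‖ ‖φ‖))`. -/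
def fubiniStudyDist (p q : ℙ ℂ H) : ℝ :=
  Real.arccos (‖⟪p.rep, q.rep⟫_ℂ‖ / (‖p.rep‖ * ‖q.rep‖))

/-- Orthogonality of rays in terms of the distance, on arbitrary representatives. -/
lemma fubiniStudyDist_mk_eq_pi_div_two_iff {x y : H} (hx : x ≠ 0) (hy : y ≠ 0) :
    fubiniStudyDist (Projectivization.mk ℂ x hx) (Projectivization.mk ℂ y hy) = Real.pi / 2 ↔
      ⟪x, y⟫_ℂ = 0 := by
  obtain ⟨a, ha⟩ := Projectivization.exists_smul_eq_mk_rep ℂ x hx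
  obtain ⟨b, hb⟩ := Projectivization.exists_smul_eq_mk_rep ℂ y hy
  rw [fubiniStudyDist, Real.arccos_eq_pi_div_two, ← ha, ← hb]
  simp [Units.smul_def, hx, hy]

/-- A frame: `n = dim H` points that are pairwise at distance `π / 2`. -/
def IsFrame (p : Fin (finrank ℂ H) → ℙ ℂ H) : Prop :=
  ∀ i j, i ≠ j → fubiniStudyDist (p i) (p j) = Real.pi / 2

/-- Frame functions: the sum of the values over a frame is the same for all frames. -/
def IsFrameFunction (f : ℙ ℂ H → ℂ) : Prop :=
  ∃ W : ℂ, ∀ p : Fin (finrank ℂ H) → ℙ ℂ H, IsFrame p → ∑ i, f (p i) = W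

/-- Density matrices: positive operators of trace one. -/
def IsDensityMatrix (σ : H →ₗ[ℂ] H) : Prop :=
  σ.IsPositive ∧ LinearMap.trace ℂ H σ = 1

/-- `ρ` describes `σ`: `ρ(p) = tr(σ p)` for every point `p`. -/
def Describes (ρ : ℙ ℂ H → ℝ) (σ : H →ₗ[ℂ] H) : Prop :=
  ∀ p, (ρ p : ℂ) = LinearMap.trace ℂ H (σ ∘ₗ projector p)

/-! ### The unitarily invariant measure -/

variable (H) [FiniteDimensional ℂ H]

/-- The `U(n)`-invariant Borel measure `μ` on the projective space with total mass `n = dim H`: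
`n` times the image of the standard Gaussian measure on `H` (as a real Euclidean space)
under `x ↦ [x]`. -/
def liouvilleMeasure : Measure (ℙ ℂ H) :=
  letI : MeasurableSpace H := borel H
  haveI : BorelSpace H := ⟨rfl⟩
  letI : InnerProductSpace ℝ H := InnerProductSpace.rclikeToReal ℂ H
  haveI : FiniteDimensional ℝ H := FiniteDimensional.complexToReal H
  (finrank ℂ H : ENNReal) •
    ((ProbabilityTheory.stdGaussian H).comap (Subtype.val : {x : H // x ≠ 0} → H)).map
      (Projectivization.mk' ℂ)

/-- The total mass is the dimension. -/
lemma liouvilleMeasure_univ : liouvilleMeasure H Set.univ = finrank ℂ H := by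
  let _ : MeasurableSpace H := borel H
  have _ : BorelSpace H := ⟨rfl⟩
  let _ : InnerProductSpace ℝ H := InnerProductSpace.rclikeToReal ℂ H
  have _ : FiniteDimensional ℝ H := FiniteDimensional.complexToReal H
  rcases Nat.eq_zero_or_pos (finrank ℂ H) with h0 | hpos
  · simp [liouvilleMeasure, h0]
  have : Nontrivial H := Module.nontrivial_of_finrank_pos hpos
  have hzero : ProbabilityTheory.stdGaussian H {(0 : H)} = 0 := by
    obtain ⟨v, hv⟩ := exists_ne (0 : H)
    let L : StrongDual ℝ H := innerSL ℝ v
    have hL : ‖L‖ ≠ 0 := by simpa [L] using hv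
    have hmap := ProbabilityTheory.IsGaussian.map_eq_gaussianReal
      (μ := ProbabilityTheory.stdGaussian H) L
    have hvar : (ProbabilityTheory.variance L (ProbabilityTheory.stdGaussian H)).toNNReal ≠ 0 := by
      rw [ProbabilityTheory.variance_dual_stdGaussian]
      have : 0 < ‖L‖ ^ 2 := by positivity
      simpa using hL
    have _ := ProbabilityTheory.nullSingletonClass_gaussianReal
      (μ := ∫ x, L x ∂(ProbabilityTheory.stdGaussian H)) hvar
    have h1 : (ProbabilityTheory.stdGaussian H).map L {(0 : ℝ)} = 0 := by
      rw [hmap]; exact measure_singleton 0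
    rw [Measure.map_apply (by fun_prop) (measurableSet_singleton _)] at h1
    refine measure_mono_null ?_ h1
    rintro x rfl
    simp
  have hm : Measurable (Projectivization.mk' ℂ (V := H)) := continuous_mk'.measurable
  have hs : MeasurableSet {x : H | x ≠ 0} := (measurableSet_singleton (0 : H)).compl
  have hone : ProbabilityTheory.stdGaussian H {x : H | x ≠ 0} = 1 := by
    have := prob_compl_eq_one_sub (μ := ProbabilityTheory.stdGaussian H)
      (measurableSet_singleton (0 : H))
    rw [hzero, tsub_zero] at this
    exact this
  have hemb : MeasurableEmbedding (Subtype.val : {x : H // x ≠ 0} → H) :=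
    MeasurableEmbedding.subtype_coe hs
  rw [liouvilleMeasure, Measure.smul_apply, Measure.map_apply hm MeasurableSet.univ,
    Set.preimage_univ, hemb.comap_apply, Set.image_univ, Subtype.range_coe_subtype, hone]
  simp

/-- The measure is invariant under the action of the unitary group. -/
lemma liouvilleMeasure_map (U : H ≃ₗᵢ[ℂ] H) :
    (liouvilleMeasure H).map
      (Projectivization.map (U.toLinearEquiv : H →ₗ[ℂ] H) U.injective) = liouvilleMeasure H := by
  let _ : MeasurableSpace H := borel H
  have _ : BorelSpace H := ⟨rfl⟩
  let _ : InnerProductSpace ℝ H := InnerProductSpace.rclikeToReal ℂ H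
  have _ : FiniteDimensional ℝ H := FiniteDimensional.complexToReal H
  have hm : Measurable (Projectivization.mk' ℂ (V := H)) := continuous_mk'.measurable
  have hs : MeasurableSet {x : H | x ≠ 0} := (measurableSet_singleton (0 : H)).compl
  have hemb : MeasurableEmbedding (Subtype.val : {x : H // x ≠ 0} → H) :=
    MeasurableEmbedding.subtype_coe hs
  let V : {x : H // x ≠ 0} → {x : H // x ≠ 0} :=
    fun x => ⟨U x.1, by simpa using x.2⟩
  have hV : Continuous V := (U.continuous.comp continuous_subtype_val).subtype_mk _
  have hcomm : Projectivization.map (U.toLinearEquiv : H →ₗ[ℂ] H) U.injective ∘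
      Projectivization.mk' ℂ = Projectivization.mk' ℂ ∘ V := rfl
  have hU : Measurable (Projectivization.map (U.toLinearEquiv : H →ₗ[ℂ] H) U.injective) := by
    refine Continuous.measurable (continuous_coinduced_dom.2 ?_)
    rw [hcomm]
    exact continuous_mk'.comp hV
  let UR : H ≃ₗᵢ[ℝ] H := ⟨U.toLinearEquiv.restrictScalars ℝ, U.norm_map⟩
  have hG : (ProbabilityTheory.stdGaussian H).map U = ProbabilityTheory.stdGaussian H :=
    ProbabilityTheory.stdGaussian_map UR
  have hcomap : ((ProbabilityTheory.stdGaussian H).comap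
      (Subtype.val : {x : H // x ≠ 0} → H)).map V =
      (ProbabilityTheory.stdGaussian H).comap (Subtype.val : {x : H // x ≠ 0} → H) := by
    ext s hsm
    rw [Measure.map_apply hV.measurable hsm, hemb.comap_apply, hemb.comap_apply]
    conv_rhs => rw [← hG, Measure.map_apply U.continuous.measurable
      (hemb.measurableSet_image.2 hsm)]
    congr 1
    ext x
    constructor
    · rintro ⟨y, hy, rfl⟩
      exact ⟨V y, hy, rfl⟩
    · rintro ⟨y, hy, hyx⟩
      have hx : x ≠ 0 := by
        rintro rfl
        exact y.2 (by simpa using hyx)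
      refine ⟨⟨x, hx⟩, ?_, rfl⟩
      have : V ⟨x, hx⟩ = y := Subtype.ext hyx.symm
      simpa [this] using hy
  rw [liouvilleMeasure, Measure.map_smul, Measure.map_map hU hm, hcomm,
    ← Measure.map_map hm hV.measurable, hcomap]

variable {H}

/-- Liouville densities: Borel frame functions with values in `[0, 1]` and integral one. -/
structure IsLiouvilleDensity (ρ : ℙ ℂ H → ℝ) : Prop where
  measurable : Measurable ρ
  mem_Icc : ∀ p, ρ p ∈ Set.Icc (0 : ℝ) 1
  frameFunction : IsFrameFunction (fun p => (ρ p : ℂ))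
  integral_eq_one : ∫ p, ρ p ∂(liouvilleMeasure H) = 1

end Single

/-! ### Bipartite systems -/

section Bipartite

variable {HA HB : Type*} [NormedAddCommGroup HA] [InnerProductSpace ℂ HA]
  [NormedAddCommGroup HB] [InnerProductSpace ℂ HB]

lemma tmul_ne_zero' {x : HA} {y : HB} (hx : x ≠ 0) (hy : y ≠ 0) : x ⊗ₜ[ℂ] y ≠ 0 := by
  rw [← norm_ne_zero_iff, TensorProduct.norm_tmul]
  exact mul_ne_zero (norm_ne_zero_iff.2 hx) (norm_ne_zero_iff.2 hy)

/-- The Segre embedding `([x], [y]) ↦ [x ⊗ y]`. -/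
def segre (p : ℙ ℂ HA × ℙ ℂ HB) : ℙ ℂ (HA ⊗[ℂ] HB) :=
  Projectivization.mk ℂ (p.1.rep ⊗ₜ[ℂ] p.2.rep)
    (tmul_ne_zero' p.1.rep_nonzero p.2.rep_nonzero)

/-- The Segre embedding may be computed on arbitrary representatives. -/
lemma segre_mk {x : HA} {y : HB} (hx : x ≠ 0) (hy : y ≠ 0) :
    segre (Projectivization.mk ℂ x hx, Projectivization.mk ℂ y hy) =
      Projectivization.mk ℂ (x ⊗ₜ[ℂ] y) (tmul_ne_zero' hx hy) := by
  obtain ⟨a, ha⟩ := Projectivization.exists_smul_eq_mk_rep ℂ x hx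
  obtain ⟨b, hb⟩ := Projectivization.exists_smul_eq_mk_rep ℂ y hy
  rw [segre, Projectivization.mk_eq_mk_iff']
  refine ⟨(a : ℂ) * b, ?_⟩
  simp only [← ha, ← hb, Units.smul_def, TensorProduct.smul_tmul_smul]

/-- Product states: `σ = σ_A ⊗ σ_B` with density matrices `σ_A`, `σ_B`. -/
def IsProductState (σ : HA ⊗[ℂ] HB →ₗ[ℂ] HA ⊗[ℂ] HB) : Prop :=
  ∃ (σA : HA →ₗ[ℂ] HA) (σB : HB →ₗ[ℂ] HB),
    IsDensityMatrix σA ∧ IsDensityMatrix σB ∧ σ = TensorProduct.map σA σB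

/-- Separable states: convex combinations `∑ λₖ σ_Aₖ ⊗ σ_Bₖ` of products of density matrices. -/
def IsSeparable (σ : HA ⊗[ℂ] HB →ₗ[ℂ] HA ⊗[ℂ] HB) : Prop :=
  ∃ (N : ℕ) (w : Fin N → ℝ) (σA : Fin N → HA →ₗ[ℂ] HA) (σB : Fin N → HB →ₗ[ℂ] HB),
    (∀ k, 0 ≤ w k) ∧ ∑ k, w k = 1 ∧
    (∀ k, IsDensityMatrix (σA k)) ∧ (∀ k, IsDensityMatrix (σB k)) ∧
    σ = ∑ k, (w k : ℂ) • TensorProduct.map (σA k) (σB k)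

/-- The marginal density of `ρ ∘ Seg` on the projective space of the first factor. -/
def marginalA [FiniteDimensional ℂ HB] (ρ : ℙ ℂ (HA ⊗[ℂ] HB) → ℝ) (pA : ℙ ℂ HA) : ℝ :=
  ∫ pB, (ρ ∘ segre) (pA, pB) ∂(liouvilleMeasure HB)

/-- The marginal density of `ρ ∘ Seg` on the projective space of the second factor. -/
def marginalB [FiniteDimensional ℂ HA] (ρ : ℙ ℂ (HA ⊗[ℂ] HB) → ℝ) (pB : ℙ ℂ HB) : ℝ :=
  ∫ pA, (ρ ∘ segre) (pA, pB) ∂(liouvilleMeasure HA)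

end Bipartite

end GeometricQM

end

noncomputable section

namespace GeometricQM

/-! ### Integrals over `ℂ³ = ℂ × (ℂ × ℂ)` -/

section Coordinates

open scoped ENNReal ComplexConjugate

/-! Everything rests on Gleason's theorem for Borel frame functions: in dimension greater than two a
Liouville density has the form `p ↦ tr(σ p)` with a density matrix `σ`
(`IsLiouvilleDensity.exists_describes`), and each density matrix yields a Liouville density
(`IsDensityMatrix.isLiouvilleDensity`). An operator on `HA ⊗ HB` is determined by its expectation
values in product vectors (`eq_of_inner_tmul_eq`), so a decomposition of `ρ ∘ Seg` lifts to one of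
`σ`. The marginals are described by the partial traces, which settles the product case.

Measurability permits a proof of Gleason's theorem by averaging. In `ℂ³`, let `h ≥ 0` have frame sum
`W`, and let `e ⊥ v` be unit vectors. The orthogonal directions `a e + b v` and `-b̄ e + ā v` are
completed to a frame by the same third direction as `e` and `v`, so both pairs give the same sum of
values of `h`. Averaging over the plane with a weight symmetric in `|a|`, `|b|` leaves `h(e) +
h(v)`; averaging over `v` and its orthogonal partner in `e⊥` leaves a multiple of `h(e) + W`. Thus
`∫ h(z) |⟨e, z⟩|² dz` over the unit ball is a universal multiple of `h(e) + W`
(`ballMoment_one_mul`). Solved for `h(e)`, this exhibits `h` as a quadratic form on unit vectors.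

In higher dimension this applies to every three-dimensional subspace. Each law of sesquilinearity
involves at most three vectors, so the polarised form is sesquilinear on the whole space
(`exists_operator_of_isFrameFunction`). -/

lemma lintegral_comp_mul_left {c : ℂ} (hc : c ≠ 0) {φ : ℂ → ℝ≥0∞} (hφ : Measurable φ) :
    ∫⁻ b, φ (c * b) = ENNReal.ofReal (‖c‖ ^ 2)⁻¹ * ∫⁻ b, φ b := by
  -- The real determinant of multiplication by `c` is the field norm of `c` over `ℝ`.
  have hdet : LinearMap.det (Algebra.lmul ℝ ℂ c) = ‖c‖ ^ 2 := by
    rw [← Algebra.norm_apply, Algebra.norm_complex_apply, Complex.normSq_eq_norm_sq]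
  have hne : LinearMap.det (Algebra.lmul ℝ ℂ c) ≠ 0 := by
    rw [hdet]; positivity
  have h := Measure.map_linearMap_addHaar_eq_smul_addHaar (volume : Measure ℂ) hne
  rw [hdet, abs_of_nonneg (by positivity)] at h
  have hm : Measurable (Algebra.lmul ℝ ℂ c) :=
    (Algebra.lmul ℝ ℂ c).continuous_of_finiteDimensional.measurable
  calc ∫⁻ b, φ (c * b) = ∫⁻ b, φ b ∂(Measure.map (Algebra.lmul ℝ ℂ c) volume) := by
        rw [lintegral_map hφ hm]; rfl
    _ = _ := by rw [h, lintegral_smul_measure, smul_eq_mul]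

lemma lintegral_comp_smul_prod {c : ℂ} (hc : c ≠ 0) {φ : ℂ × ℂ → ℝ≥0∞} (hφ : Measurable φ) :
    ∫⁻ v, φ (c • v) = ENNReal.ofReal (‖c‖ ^ 4)⁻¹ * ∫⁻ v, φ v := by
  have h1 : Measurable fun v : ℂ × ℂ => φ (c • v) := hφ.comp (measurable_const_smul c)
  rw [Measure.volume_eq_prod, lintegral_prod _ h1.aemeasurable, lintegral_prod _ hφ.aemeasurable]
  have h2 (x : ℂ) : ∫⁻ y, φ (c • (x, y)) =
      ENNReal.ofReal (‖c‖ ^ 2)⁻¹ * ∫⁻ y, φ (c * x, y) :=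
    lintegral_comp_mul_left hc (φ := fun y => φ (c * x, y)) (by fun_prop)
  simp_rw [h2]
  rw [lintegral_const_mul' _ _ ENNReal.ofReal_ne_top,
    lintegral_comp_mul_left hc (φ := fun x => ∫⁻ y, φ (x, y)) hφ.lintegral_prod_right',
    ← mul_assoc, ← ENNReal.ofReal_mul (by positivity)]
  congr 2
  field_simp

/-- The square of the Euclidean norm on `ℂ²`. -/
def sqNorm (v : ℂ × ℂ) : ℝ := ‖v.1‖ ^ 2 + ‖v.2‖ ^ 2

@[fun_prop]
lemma continuous_sqNorm : Continuous sqNorm := by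
  unfold sqNorm; fun_prop

@[fun_prop]
lemma measurable_sqNorm : Measurable sqNorm := continuous_sqNorm.measurable

lemma sqNorm_nonneg (v : ℂ × ℂ) : 0 ≤ sqNorm v := by unfold sqNorm; positivity

lemma sqNorm_pos {v : ℂ × ℂ} (hv : v ≠ 0) : 0 < sqNorm v := by
  refine (sqNorm_nonneg v).lt_of_ne' fun h => hv ?_
  unfold sqNorm at h
  have h1 : ‖v.1‖ ^ 2 = 0 := by nlinarith [sq_nonneg ‖v.1‖, sq_nonneg ‖v.2‖]
  have h2 : ‖v.2‖ ^ 2 = 0 := by nlinarith [sq_nonneg ‖v.1‖, sq_nonneg ‖v.2‖]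
  exact Prod.ext (by simpa using h1) (by simpa using h2)

lemma sqNorm_smul (c : ℂ) (v : ℂ × ℂ) : sqNorm (c • v) = ‖c‖ ^ 2 * sqNorm v := by
  simp [sqNorm]; ring

lemma ae_ne_zero : ∀ᵐ v : ℂ × ℂ, v ≠ 0 := by
  rw [Measure.volume_eq_prod]
  exact compl_mem_ae_iff.2 (measure_singleton _)

/-- The indicator function of the shell `1 ≤ t ≤ 4`. -/
def shell (t : ℝ) : ℝ≥0∞ := (Set.Icc (1 : ℝ) 4).indicator 1 t

@[fun_prop]
lemma measurable_shell : Measurable shell := measurable_one.indicator measurableSet_Icc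

/-- Averaging a function on `ℂ²` over dilations of a spherical shell by complex scalars amounts to
integrating it against the weight `sqNorm⁻¹`. -/
lemma lintegral_shell_smul {k : ℂ × ℂ → ℝ≥0∞} (hk : Measurable k) :
    ∫⁻ v, shell (sqNorm v) * ∫⁻ b : ℂ, k (b • v) =
      (∫⁻ c : ℂ, ENNReal.ofReal (‖c‖ ^ 4)⁻¹ * shell (‖c‖ ^ 2)⁻¹) *
        ∫⁻ v, ENNReal.ofReal (sqNorm v)⁻¹ * k v := by
  have hsm : Measurable fun p : (ℂ × ℂ) × ℂ => k (p.2 • p.1) :=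
    hk.comp (measurable_snd.smul measurable_fst)
  -- Once the integrals are swapped, `b` is absorbed into `v`, with Jacobian `‖b‖⁻⁴`.
  have e1 : ∫⁻ v, shell (sqNorm v) * ∫⁻ b : ℂ, k (b • v) =
      ∫⁻ b : ℂ, ∫⁻ v, shell (sqNorm v) * k (b • v) := by
    rw [lintegral_lintegral_swap (by fun_prop)]
    refine lintegral_congr fun v => ?_
    rw [lintegral_const_mul]
    exact hsm.comp (measurable_prodMk_left)
  have e2 : ∀ b : ℂ, b ≠ 0 → ∫⁻ v, shell (sqNorm v) * k (b • v) =
      ∫⁻ v, ENNReal.ofReal (‖b‖ ^ 4)⁻¹ * shell (sqNorm v / ‖b‖ ^ 2) * k v := by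
    intro b hb
    have := lintegral_comp_smul_prod hb (φ := fun v => shell (sqNorm v / ‖b‖ ^ 2) * k v)
      (by fun_prop)
    simp_rw [mul_assoc]
    rw [lintegral_const_mul _ (by fun_prop), ← this]
    refine lintegral_congr fun v => ?_
    rw [sqNorm_smul, mul_div_cancel_left₀ _ (by positivity)]
  have e3 : ∫⁻ b : ℂ, ∫⁻ v, shell (sqNorm v) * k (b • v) =
      ∫⁻ b : ℂ, ∫⁻ v, ENNReal.ofReal (‖b‖ ^ 4)⁻¹ * shell (sqNorm v / ‖b‖ ^ 2) * k v := by
    refine lintegral_congr_ae ?_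
    filter_upwards [compl_mem_ae_iff.2 (measure_singleton (0 : ℂ))] with b hb using e2 b hb
  rw [e1, e3, lintegral_lintegral_swap (by fun_prop), ← lintegral_const_mul _ (by fun_prop)]
  refine lintegral_congr_ae ?_
  filter_upwards [ae_ne_zero] with v hv
  have hq : 0 < sqNorm v := sqNorm_pos hv
  rw [lintegral_mul_const _ (by fun_prop), ← mul_assoc]
  congr 1
  -- The substitution `b = √(sqNorm v) c` turns the integral over `b` into the constant divided by
  -- `sqNorm v`. The resulting identity carries one more factor `(sqNorm v)⁻¹` on each side, which
  -- is cancelled.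
  have hs : 0 < √(sqNorm v) := Real.sqrt_pos.2 hq
  have hs2 : √(sqNorm v) ^ 2 = sqNorm v := Real.sq_sqrt hq.le
  have := lintegral_comp_mul_left (c := ((√(sqNorm v) : ℝ) : ℂ)) (by exact_mod_cast hs.ne')
    (φ := fun b => ENNReal.ofReal (‖b‖ ^ 4)⁻¹ * shell (sqNorm v / ‖b‖ ^ 2)) (by fun_prop)
  simp only [norm_mul, Complex.norm_real, Real.norm_eq_abs, abs_of_pos hs, mul_pow, hs2] at this
  have h4 : √(sqNorm v) ^ 4 = sqNorm v ^ 2 := by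
    rw [← hs2, ← pow_mul]; simp [hs2]
  simp only [h4] at this
  have hne : ENNReal.ofReal (sqNorm v)⁻¹ ≠ 0 := by simpa using hq
  refine (ENNReal.mul_right_inj hne ENNReal.ofReal_ne_top).1 (this.symm.trans ?_)
  rw [mul_comm (∫⁻ c : ℂ, _), ← mul_assoc, ← lintegral_const_mul' _ _ (by finiteness)]
  refine lintegral_congr fun c => ?_
  rw [← mul_assoc, mul_inv, ENNReal.ofReal_mul (by positivity), div_mul_cancel_left₀ hq.ne',
    sq, mul_inv, ENNReal.ofReal_mul (by positivity)]

/-- The indicator function of the interval `t ≤ 1`. -/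
def cutoff (t : ℝ) : ℝ≥0∞ := (Set.Iic (1 : ℝ)).indicator 1 t

@[fun_prop]
lemma measurable_cutoff : Measurable cutoff := measurable_one.indicator measurableSet_Iic

lemma lintegral_comp_conj {φ : ℂ → ℝ≥0∞} (hφ : Measurable φ) :
    ∫⁻ a, φ (conj a) = ∫⁻ a, φ a :=
  (LinearIsometryEquiv.measurePreserving Complex.conjLIE).lintegral_comp hφ

lemma lintegral_comp_neg_conj {φ : ℂ → ℝ≥0∞} (hφ : Measurable φ) :
    ∫⁻ a, φ (-conj a) = ∫⁻ a, φ a := by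
  rw [lintegral_comp_conj (φ := fun a => φ (-a)) (by fun_prop)]
  exact (Measure.measurePreserving_neg volume).lintegral_comp hφ

/-- The map `(a, b) ↦ (-b̄, ā)` takes a vector of `ℂ²` to an orthogonal one of equal norm, and it
preserves volume as a swap followed by reflections. It serves twice: for `(a, b)` within a plane and
for `v` itself. -/
lemma lintegral_comp_quarter_turn {φ : ℂ × ℂ → ℝ≥0∞} (hφ : Measurable φ) :
    ∫⁻ a, ∫⁻ b, φ (-conj b, conj a) = ∫⁻ a, ∫⁻ b, φ (a, b) := by
  have hc : Measurable (conj : ℂ → ℂ) := Complex.continuous_conj.measurable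
  rw [lintegral_lintegral_swap (by fun_prop)]
  rw [← lintegral_comp_neg_conj (φ := fun a => ∫⁻ b, φ (a, b)) hφ.lintegral_prod_right']
  exact lintegral_congr fun b =>
    lintegral_comp_conj (φ := fun a => φ (-conj b, a)) (by fun_prop)

/-- Pairs `z`, `z'` of orthogonal directions in a two-dimensional subspace of `ℂ³` contribute the
same to `h`, so that an average over that subspace can be evaluated. -/
lemma two_mul_lintegral_plane {h : ℂ × (ℂ × ℂ) → ℝ≥0∞} (hm : Measurable h)
    (hsmul : ∀ (c : ℂ) z, c ≠ 0 → h (c • z) = h z)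
    (hpair : ∀ (a b : ℂ) (v : ℂ × ℂ), sqNorm v = 1 → a ≠ 0 → b ≠ 0 →
      h (a, b • v) + h (-conj b, conj a • v) = h (1, 0) + h (0, v))
    {v : ℂ × ℂ} (hv : v ≠ 0) :
    2 * ∫⁻ a : ℂ, ∫⁻ b : ℂ, h (a, b • v) * (ENNReal.ofReal (‖a‖ ^ 2 * sqNorm (b • v)) *
        cutoff (‖a‖ ^ 2 + sqNorm (b • v))) =
      (∫⁻ a : ℂ, ∫⁻ b : ℂ, ENNReal.ofReal (‖a‖ ^ 2 * ‖b‖ ^ 2) * cutoff (‖a‖ ^ 2 + ‖b‖ ^ 2)) *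
        (ENNReal.ofReal (sqNorm v)⁻¹ * (h (1, 0) + h (0, v))) := by
  have hq : 0 < sqNorm v := sqNorm_pos hv
  set s : ℝ := √(sqNorm v) with hs_def
  have hs : 0 < s := Real.sqrt_pos.2 hq
  have hs2 : s ^ 2 = sqNorm v := Real.sq_sqrt hq.le
  have hsC : (s : ℂ) ≠ 0 := by exact_mod_cast hs.ne'
  -- `hpair` speaks of unit vectors; rescaling `b` to pass from `v` to `u` produces the factor
  -- `(sqNorm v)⁻¹`.
  set u : ℂ × ℂ := (s : ℂ)⁻¹ • v with hu_def
  have hu : sqNorm u = 1 := by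
    rw [hu_def, sqNorm_smul, norm_inv, Complex.norm_real, Real.norm_eq_abs, abs_of_pos hs, ← hs2]
    field_simp
  have hvu : v = (s : ℂ) • u := by rw [hu_def, smul_inv_smul₀ hsC]
  have h0 : h (0, v) = h (0, u) := by
    rw [hvu, ← hsmul s (0, u) hsC]; simp
  set w : ℂ × ℂ → ℝ≥0∞ := fun p =>
    ENNReal.ofReal (‖p.1‖ ^ 2 * ‖p.2‖ ^ 2) * cutoff (‖p.1‖ ^ 2 + ‖p.2‖ ^ 2) with hw_def
  have hw (a b : ℂ) : w (-conj b, conj a) = w (a, b) := by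
    simp only [hw_def, norm_neg, RCLike.norm_conj]
    rw [mul_comm (‖b‖ ^ 2), add_comm (‖b‖ ^ 2)]
  have hwm : Measurable w := by fun_prop
  have hφ : Measurable fun p : ℂ × ℂ => h (p.1, p.2 • u) * w p :=
    (hm.comp (measurable_fst.prodMk (measurable_snd.smul_const u))).mul hwm
  have e1 (a : ℂ) : ∫⁻ b : ℂ, h (a, b • v) * (ENNReal.ofReal (‖a‖ ^ 2 * sqNorm (b • v)) *
        cutoff (‖a‖ ^ 2 + sqNorm (b • v))) =
      ENNReal.ofReal (sqNorm v)⁻¹ * ∫⁻ b : ℂ, h (a, b • u) * w (a, b) := by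
    have := lintegral_comp_mul_left hsC (φ := fun b => h (a, b • u) * w (a, b))
      (hφ.comp measurable_prodMk_left)
    rw [Complex.norm_real, Real.norm_eq_abs, abs_of_pos hs, hs2] at this
    rw [← this]
    refine lintegral_congr fun b => ?_
    have hb : (((s : ℂ) * b) • u) = b • v := by rw [mul_comm, mul_smul, ← hvu]
    simp only [hw_def]
    rw [hb, sqNorm_smul, norm_mul, Complex.norm_real, Real.norm_eq_abs, abs_of_pos hs, mul_pow,
      hs2, mul_comm (‖b‖ ^ 2)]
  -- The weight is invariant under the quarter turn, so twice the integral is the integral of the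
  -- sum over an orthogonal pair, which `hpair` evaluates off the null sets `a = 0` and `b = 0`.
  have e2 : 2 * ∫⁻ a : ℂ, ∫⁻ b : ℂ, h (a, b • u) * w (a, b) =
      ∫⁻ a : ℂ, ∫⁻ b : ℂ, w (a, b) * (h (1, 0) + h (0, u)) := by
    have e3 := lintegral_comp_quarter_turn hφ
    simp only [hw] at e3
    rw [two_mul]
    conv_lhs => enter [2]; rw [← e3]
    rw [← lintegral_add_left hφ.lintegral_prod_right']
    refine lintegral_congr_ae ?_
    filter_upwards [compl_mem_ae_iff.2 (measure_singleton (0 : ℂ))] with a ha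
    have hφa : Measurable fun b : ℂ => h (a, b • u) * w (a, b) :=
      hφ.comp measurable_prodMk_left
    rw [← lintegral_add_left hφa]
    refine lintegral_congr_ae ?_
    filter_upwards [compl_mem_ae_iff.2 (measure_singleton (0 : ℂ))] with b hb
    rw [← hpair a b u hu ha hb]
    ring
  have hwm' : Measurable fun a => ∫⁻ b, w (a, b) := hwm.lintegral_prod_right'
  simp_rw [e1]
  rw [lintegral_const_mul _ hφ.lintegral_prod_right', mul_left_comm, e2, h0]
  have e4 (a : ℂ) : ∫⁻ b : ℂ, w (a, b) * (h (1, 0) + h (0, u)) =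
      (∫⁻ b : ℂ, w (a, b)) * (h (1, 0) + h (0, u)) :=
    lintegral_mul_const _ (hwm.comp measurable_prodMk_left)
  simp_rw [e4]
  rw [lintegral_mul_const _ hwm', mul_left_comm]

/-- The constant of `lintegral_shell_smul`. -/
def shellConst : ℝ≥0∞ := ∫⁻ c : ℂ, ENNReal.ofReal (‖c‖ ^ 4)⁻¹ * shell (‖c‖ ^ 2)⁻¹

/-- The integrand is positive on the annulus `1/2 < ‖c‖ < 1`. With finiteness, this allows
cancellation in `ℝ≥0∞`. -/
lemma shellConst_ne_zero : shellConst ≠ 0 := by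
  intro h
  rw [shellConst, lintegral_eq_zero_iff (by fun_prop)] at h
  have hopen : IsOpen {c : ℂ | 1 / 2 < ‖c‖ ∧ ‖c‖ < 1} :=
    (isOpen_lt continuous_const continuous_norm).inter (isOpen_lt continuous_norm continuous_const)
  have hpos : 0 < volume {c : ℂ | 1 / 2 < ‖c‖ ∧ ‖c‖ < 1} := by
    refine hopen.measure_pos _ ⟨((3 / 4 : ℝ) : ℂ), ?_⟩
    simp only [Set.mem_ofPred_eq, Complex.norm_real]
    norm_num
  refine hpos.ne' (measure_mono_null ?_ h)
  rintro c ⟨hc1, hc2⟩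
  have hc0 : 0 < ‖c‖ := by linarith
  have hmem : (‖c‖ ^ 2)⁻¹ ∈ Set.Icc (1 : ℝ) 4 := by
    constructor
    · exact (one_le_inv₀ (by positivity)).2 (by nlinarith)
    · rw [inv_le_comm₀ (by positivity) (by norm_num)]; nlinarith
  simp only [Set.mem_compl_iff, Set.mem_ofPred_eq, shell, Set.indicator_of_mem hmem]
  simp [hc0]

/-- The end 4 of the shell keeps `‖c‖ ≥ 1/2`, away from the singularity of `‖c‖⁻⁴`; the end 1 keeps
`‖c‖ ≤ 1`. -/
lemma shellConst_ne_top : shellConst ≠ ∞ := by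
  have hle : shellConst ≤ ∫⁻ c in Metric.closedBall (0 : ℂ) 1, 16 := by
    rw [shellConst, ← lintegral_indicator Metric.isClosed_closedBall.measurableSet]
    refine lintegral_mono fun c => ?_
    by_cases hmem : (‖c‖ ^ 2)⁻¹ ∈ Set.Icc (1 : ℝ) 4
    · have hc0 : 0 < ‖c‖ := by
        refine (norm_nonneg c).lt_of_ne fun h => ?_
        rw [← h] at hmem; norm_num at hmem
      have hc1 : ‖c‖ ^ 2 ≤ 1 := (one_le_inv₀ (by positivity)).1 hmem.1
      have hc2 : (‖c‖ ^ 4)⁻¹ ≤ 16 := by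
        have h2 : (‖c‖ ^ 4)⁻¹ = (‖c‖ ^ 2)⁻¹ * (‖c‖ ^ 2)⁻¹ := by
          rw [← mul_inv]; ring_nf
        rw [h2]; nlinarith [hmem.1, hmem.2]
      have hc3 : c ∈ Metric.closedBall (0 : ℂ) 1 := by
        rw [mem_closedBall_zero_iff]; nlinarith
      rw [shell, Set.indicator_of_mem hmem, Set.indicator_of_mem hc3]
      simpa using ENNReal.ofReal_le_ofReal hc2
    · rw [shell, Set.indicator_of_notMem hmem]; simp
  refine ne_top_of_le_ne_top ?_ hle
  rw [setLIntegral_const]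
  exact ENNReal.mul_ne_top (by norm_num) (isCompact_closedBall _ _).measure_ne_top

/-- The integral `∫ h(z) |z₁|² dz` over the unit ball of `ℂ³`. -/
def ballMoment (h : ℂ × (ℂ × ℂ) → ℝ≥0∞) : ℝ≥0∞ :=
  ∫⁻ z, h z * (ENNReal.ofReal (‖z.1‖ ^ 2) * cutoff (‖z.1‖ ^ 2 + sqNorm z.2))

/-- One integral of `h z ‖z₁‖² sqNorm z₂` is computed in two ways. Spread over `ℂ³` by
`lintegral_shell_smul`, the factor `sqNorm z₂` cancels the weight and `ballMoment h` remains; plane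
by plane, `two_mul_lintegral_plane` applies. The factor 4 comes from two symmetrisations, one over
`(a, b)` and one over `v`. -/
lemma shellConst_mul_ballMoment {h : ℂ × (ℂ × ℂ) → ℝ≥0∞} (hm : Measurable h) {W : ℝ≥0∞}
    (hsmul : ∀ (c : ℂ) z, c ≠ 0 → h (c • z) = h z)
    (hpair : ∀ (a b : ℂ) (v : ℂ × ℂ), sqNorm v = 1 → a ≠ 0 → b ≠ 0 →
      h (a, b • v) + h (-conj b, conj a • v) = h (1, 0) + h (0, v))
    (hframe : ∀ v : ℂ × ℂ, v ≠ 0 → h (1, 0) + h (0, v) + h (0, (-conj v.2, conj v.1)) = W) :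
    4 * (shellConst * ballMoment h) =
      (∫⁻ a : ℂ, ∫⁻ b : ℂ, ENNReal.ofReal (‖a‖ ^ 2 * ‖b‖ ^ 2) * cutoff (‖a‖ ^ 2 + ‖b‖ ^ 2)) *
        (∫⁻ v, shell (sqNorm v) * ENNReal.ofReal (sqNorm v)⁻¹) * (h (1, 0) + W) := by
  set K := ∫⁻ a : ℂ, ∫⁻ b : ℂ,
    ENNReal.ofReal (‖a‖ ^ 2 * ‖b‖ ^ 2) * cutoff (‖a‖ ^ 2 + ‖b‖ ^ 2)
  set Ψ : ℂ × (ℂ × ℂ) → ℝ≥0∞ := fun z => h z * (ENNReal.ofReal (‖z.1‖ ^ 2 * sqNorm z.2) *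
    cutoff (‖z.1‖ ^ 2 + sqNorm z.2)) with hΨ
  have hΨm : Measurable Ψ := by fun_prop
  have hc : Measurable (conj : ℂ → ℂ) := Complex.continuous_conj.measurable
  have e1 : ∫⁻ v, shell (sqNorm v) * ∫⁻ b : ℂ, ∫⁻ a : ℂ, Ψ (a, b • v) =
      shellConst * ballMoment h := by
    have e0 : ballMoment h = ∫⁻ v : ℂ × ℂ, ∫⁻ a : ℂ, h (a, v) *
        (ENNReal.ofReal (‖a‖ ^ 2) * cutoff (‖a‖ ^ 2 + sqNorm v)) :=
      lintegral_prod_symm' _ (by fun_prop)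
    rw [lintegral_shell_smul (k := fun v => ∫⁻ a, Ψ (a, v)) hΨm.lintegral_prod_left', ← shellConst,
      e0]
    congr 1
    refine lintegral_congr_ae ?_
    filter_upwards [ae_ne_zero] with v hv
    have hq := sqNorm_pos hv
    rw [← lintegral_const_mul' _ _ ENNReal.ofReal_ne_top]
    refine lintegral_congr fun a => ?_
    simp only [hΨ]
    rw [ENNReal.ofReal_mul (by positivity), mul_left_comm]
    congr 1
    rw [mul_comm (ENNReal.ofReal (‖a‖ ^ 2)), ← mul_assoc, ← mul_assoc,
      ← ENNReal.ofReal_mul (by positivity), inv_mul_cancel₀ hq.ne', ENNReal.ofReal_one, one_mul]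
  have hsm : Measurable fun p : (ℂ × ℂ) × ℂ × ℂ => Ψ (p.2.1, p.2.2 • p.1) :=
    hΨm.comp (by fun_prop)
  have e2 : 2 * (shellConst * ballMoment h) =
      K * ∫⁻ v, shell (sqNorm v) * ENNReal.ofReal (sqNorm v)⁻¹ * (h (1, 0) + h (0, v)) := by
    rw [← e1, ← lintegral_const_mul' _ _ (by finiteness), ← lintegral_const_mul _ (by fun_prop)]
    refine lintegral_congr_ae ?_
    filter_upwards [ae_ne_zero] with v hv
    have hsv : Measurable fun p : ℂ × ℂ => Ψ (p.1, p.2 • v) := hΨm.comp (by fun_prop)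
    have := two_mul_lintegral_plane hm hsmul hpair hv
    rw [mul_left_comm, mul_assoc, mul_left_comm K, ← this,
      ← lintegral_lintegral_swap (f := fun a b => Ψ (a, b • v)) hsv.aemeasurable]
  -- Replacing `v` by its orthogonal partner keeps the weight. Adding both versions brings in `2
  -- h(1,0) + h(0,v) + h(0,v⊥) = h(1,0) + W`.
  have e3 : ∫⁻ v, shell (sqNorm v) * ENNReal.ofReal (sqNorm v)⁻¹ * (h (1, 0) + h (0, v)) =
      ∫⁻ v, shell (sqNorm v) * ENNReal.ofReal (sqNorm v)⁻¹ *
        (h (1, 0) + h (0, (-conj v.2, conj v.1))) := by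
    have := lintegral_comp_quarter_turn (φ := fun v =>
      shell (sqNorm v) * ENNReal.ofReal (sqNorm v)⁻¹ * (h (1, 0) + h (0, v))) (by fun_prop)
    rw [Measure.volume_eq_prod, lintegral_prod _ (by fun_prop), ← this,
      lintegral_prod _ (by fun_prop)]
    refine lintegral_congr fun a => lintegral_congr fun b => ?_
    simp [sqNorm, add_comm]
  calc 4 * (shellConst * ballMoment h)
      = 2 * (shellConst * ballMoment h) + 2 * (shellConst * ballMoment h) := by ring
    _ = _ := by
      rw [e2]
      conv_lhs => enter [2]; rw [e3]
      rw [← mul_add, ← lintegral_add_left (by fun_prop), mul_assoc]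
      congr 1
      rw [← lintegral_mul_const _ (by fun_prop)]
      refine lintegral_congr_ae ?_
      filter_upwards [ae_ne_zero] with v hv
      rw [← mul_add, ← hframe v hv]
      ring

/-- The integral formula behind Gleason's theorem in dimension three: the value of a frame function
at a point is determined by its second moments. -/
lemma ballMoment_one_mul {h : ℂ × (ℂ × ℂ) → ℝ≥0∞} (hm : Measurable h) {W : ℝ≥0∞}
    (hsmul : ∀ (c : ℂ) z, c ≠ 0 → h (c • z) = h z)
    (hpair : ∀ (a b : ℂ) (v : ℂ × ℂ), sqNorm v = 1 → a ≠ 0 → b ≠ 0 →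
      h (a, b • v) + h (-conj b, conj a • v) = h (1, 0) + h (0, v))
    (hframe : ∀ v : ℂ × ℂ, v ≠ 0 → h (1, 0) + h (0, v) + h (0, (-conj v.2, conj v.1)) = W) :
    ballMoment 1 * (h (1, 0) + W) = 4 * ballMoment h := by
  have h1 := shellConst_mul_ballMoment hm hsmul hpair hframe
  -- The constant function 1 has frame sum 3; comparison with it eliminates the two remaining
  -- integrals.
  have h2 := shellConst_mul_ballMoment (h := 1) (W := 3) measurable_one (by simp) (by simp)
    (by intros; norm_num)
  refine (ENNReal.mul_right_inj shellConst_ne_zero shellConst_ne_top).1 ?_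
  rw [Pi.one_apply, show (1 : ℝ≥0∞) + 3 = 4 by norm_num, mul_comm _ 4,
    ENNReal.mul_right_inj (by norm_num) (by norm_num)] at h2
  rw [← mul_assoc, h2, ← h1, mul_left_comm]

lemma ballMoment_one_ne_zero : ballMoment 1 ≠ 0 := by
  intro h
  rw [ballMoment, lintegral_eq_zero_iff (by fun_prop)] at h
  have hopen : IsOpen {z : ℂ × (ℂ × ℂ) | 0 < ‖z.1‖ ∧ ‖z.1‖ ^ 2 + sqNorm z.2 < 1} := by
    have h1 : Continuous fun z : ℂ × (ℂ × ℂ) => ‖z.1‖ := by fun_prop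
    have h2 : Continuous fun z : ℂ × (ℂ × ℂ) => ‖z.1‖ ^ 2 + sqNorm z.2 := by fun_prop
    exact (isOpen_lt continuous_const h1).inter (isOpen_lt h2 continuous_const)
  have hpos : 0 < volume {z : ℂ × (ℂ × ℂ) | 0 < ‖z.1‖ ∧ ‖z.1‖ ^ 2 + sqNorm z.2 < 1} := by
    refine hopen.measure_pos _ ⟨(((1 / 2 : ℝ) : ℂ), 0), ?_⟩
    simp only [Set.mem_ofPred_eq, Complex.norm_real, sqNorm]
    norm_num
  refine hpos.ne' (measure_mono_null ?_ h)
  rintro z ⟨hz1, hz2⟩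
  simp only [Set.mem_compl_iff, Set.mem_ofPred_eq, cutoff]
  rw [Set.indicator_of_mem (show _ ∈ Set.Iic (1 : ℝ) from hz2.le)]
  simpa using hz1

lemma ballMoment_one_ne_top : ballMoment 1 ≠ ∞ := by
  have hle : ballMoment 1 ≤ ∫⁻ z in Metric.closedBall (0 : ℂ × (ℂ × ℂ)) 1, 1 := by
    rw [ballMoment, ← lintegral_indicator Metric.isClosed_closedBall.measurableSet]
    refine lintegral_mono fun z => ?_
    by_cases hmem : ‖z.1‖ ^ 2 + sqNorm z.2 ∈ Set.Iic (1 : ℝ)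
    · have hz := Set.mem_Iic.1 hmem
      have hz1 := sqNorm_nonneg z.2
      have hz3 : z ∈ Metric.closedBall (0 : ℂ × (ℂ × ℂ)) 1 := by
        rw [mem_closedBall_zero_iff]
        unfold sqNorm at hz
        refine norm_prod_le_iff.2 ⟨?_, norm_prod_le_iff.2 ⟨?_, ?_⟩⟩ <;>
          nlinarith [sq_nonneg ‖z.1‖, sq_nonneg ‖z.2.1‖, sq_nonneg ‖z.2.2‖]
      rw [cutoff, Set.indicator_of_mem hmem, Set.indicator_of_mem hz3]
      have hz4 := ENNReal.ofReal_le_ofReal (by linarith : ‖z.1‖ ^ 2 ≤ 1)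
      rw [ENNReal.ofReal_one] at hz4
      simpa only [Pi.one_apply, one_mul, mul_one] using hz4
    · rw [cutoff, Set.indicator_of_notMem hmem]; simp
  refine ne_top_of_le_ne_top ?_ hle
  rw [setLIntegral_const]
  exact ENNReal.mul_ne_top (by norm_num) (isCompact_closedBall _ _).measure_ne_top

end Coordinates

end GeometricQM

end

noncomputable section

namespace GeometricQM

/-! ### Frame functions in dimension three -/

section DimensionThree

open scoped ENNReal ComplexConjugate

/-- The product carries the maximum norm, so `M` need not be isometric for it. A linear automorphism
multiplies volume by a constant, and `M` preserves the Euclidean unit ball, of positive finite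
volume; hence the constant is 1. -/
lemma map_volume_of_isometry (M : (ℂ × (ℂ × ℂ)) ≃ₗ[ℂ] (ℂ × (ℂ × ℂ)))
    (hM : ∀ z, ‖(M z).1‖ ^ 2 + sqNorm (M z).2 = ‖z.1‖ ^ 2 + sqNorm z.2) :
    Measure.map M volume = volume := by
  set S : Set (ℂ × (ℂ × ℂ)) := {z | ‖z.1‖ ^ 2 + sqNorm z.2 ≤ 1} with hS
  have hcont : Continuous fun z : ℂ × (ℂ × ℂ) => ‖z.1‖ ^ 2 + sqNorm z.2 := by fun_prop
  have hSm : MeasurableSet S := (isClosed_le hcont continuous_const).measurableSet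
  have hpos : volume S ≠ 0 := by
    have hlt : IsOpen {z : ℂ × (ℂ × ℂ) | ‖z.1‖ ^ 2 + sqNorm z.2 < 1} :=
      isOpen_lt hcont continuous_const
    have : 0 < volume {z : ℂ × (ℂ × ℂ) | ‖z.1‖ ^ 2 + sqNorm z.2 < 1} :=
      hlt.measure_pos _ ⟨0, by simp [sqNorm]⟩
    exact (this.trans_le (measure_mono fun z hz => le_of_lt (a := ‖z.1‖ ^ 2 + sqNorm z.2) hz)).ne'
  have hfin : volume S ≠ ∞ := by
    refine ne_top_of_le_ne_top
      (isCompact_closedBall (0 : ℂ × (ℂ × ℂ)) 1).measure_ne_top (measure_mono fun z hz => ?_)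
    have hz : ‖z.1‖ ^ 2 + sqNorm z.2 ≤ 1 := hz
    unfold sqNorm at hz
    rw [mem_closedBall_zero_iff]
    refine norm_prod_le_iff.2 ⟨?_, norm_prod_le_iff.2 ⟨?_, ?_⟩⟩ <;>
      nlinarith [sq_nonneg ‖z.1‖, sq_nonneg ‖z.2.1‖, sq_nonneg ‖z.2.2‖]
  have hvol : (volume : Measure (ℂ × ℂ)).IsAddHaarMeasure :=
    Measure.prod.instIsAddHaarMeasure volume volume
  have hvol' : (volume : Measure (ℂ × (ℂ × ℂ))).IsAddHaarMeasure :=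
    Measure.prod.instIsAddHaarMeasure volume volume
  have hdet : LinearMap.det ((M.restrictScalars ℝ : _ ≃ₗ[ℝ] _) : _ →ₗ[ℝ] (ℂ × (ℂ × ℂ))) ≠ 0 :=
    (LinearEquiv.isUnit_det' (M.restrictScalars ℝ)).ne_zero
  have h := Measure.map_linearMap_addHaar_eq_smul_addHaar
    (volume : Measure (ℂ × (ℂ × ℂ))) hdet
  set c := ENNReal.ofReal
    |(LinearMap.det ((M.restrictScalars ℝ : _ ≃ₗ[ℝ] _) : _ →ₗ[ℝ] (ℂ × (ℂ × ℂ))))⁻¹|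
  change Measure.map M volume = c • volume at h
  have hMc : Continuous M.toLinearMap := LinearMap.continuous_of_finiteDimensional _
  have hMm : Measurable M := hMc.measurable
  have hpre : M ⁻¹' S = S := by
    ext z; simp only [hS, Set.mem_preimage, Set.mem_ofPred_eq, hM]
  have h1 := congrArg (fun μ => μ S) h
  simp only [Measure.map_apply hMm hSm, hpre, Measure.smul_apply, smul_eq_mul] at h1
  have hc : c = 1 := by
    refine (ENNReal.mul_left_inj hpos hfin).1 ?_
    rw [← h1, one_mul]
  rw [h, hc, one_smul]

variable {V : Type*} [NormedAddCommGroup V] [InnerProductSpace ℂ V]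

/-- The coordinates of a three-dimensional space in an orthonormal basis. -/
def coordEquiv (b : OrthonormalBasis (Fin 3) ℂ V) : (ℂ × (ℂ × ℂ)) ≃ₗ[ℂ] V where
  toFun z := z.1 • b 0 + z.2.1 • b 1 + z.2.2 • b 2
  map_add' z w := by simp only [Prod.fst_add, Prod.snd_add]; module
  map_smul' c z := by
    simp only [Prod.smul_fst, Prod.smul_snd, smul_eq_mul, RingHom.id_apply]; module
  invFun x := (⟪b 0, x⟫_ℂ, ⟪b 1, x⟫_ℂ, ⟪b 2, x⟫_ℂ)
  left_inv z := by
    have hb := orthonormal_iff_ite.1 b.orthonormal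
    simp [hb]
  right_inv x := by
    simpa [Fin.sum_univ_three] using b.sum_repr' x

lemma coordEquiv_apply (b : OrthonormalBasis (Fin 3) ℂ V) (z : ℂ × (ℂ × ℂ)) :
    coordEquiv b z = z.1 • b 0 + z.2.1 • b 1 + z.2.2 • b 2 := rfl

lemma inner_coordEquiv (b : OrthonormalBasis (Fin 3) ℂ V) (z w : ℂ × (ℂ × ℂ)) :
    ⟪coordEquiv b z, coordEquiv b w⟫_ℂ =
      conj z.1 * w.1 + conj z.2.1 * w.2.1 + conj z.2.2 * w.2.2 := by
  have hb := orthonormal_iff_ite.1 b.orthonormal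
  simp only [coordEquiv_apply, inner_add_right, inner_add_left, inner_smul_right, inner_smul_left,
    hb]
  simp [mul_comm]

lemma norm_sq_coordEquiv (b : OrthonormalBasis (Fin 3) ℂ V) (z : ℂ × (ℂ × ℂ)) :
    ‖coordEquiv b z‖ ^ 2 = ‖z.1‖ ^ 2 + sqNorm z.2 := by
  have h := inner_self_eq_norm_sq_to_K (𝕜 := ℂ) (coordEquiv b z)
  rw [inner_coordEquiv, ← RCLike.ofReal_pow] at h
  simp only [RCLike.conj_mul] at h
  rw [sqNorm, ← add_assoc]
  exact_mod_cast h.symm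

lemma inner_zero_coordEquiv (b : OrthonormalBasis (Fin 3) ℂ V) (z : ℂ × (ℂ × ℂ)) :
    ⟪b 0, coordEquiv b z⟫_ℂ = z.1 := by
  have hb := orthonormal_iff_ite.1 b.orthonormal
  simp [coordEquiv_apply, hb]

/-- The sum of the values of `f` over three orthogonal directions is determined by its sums over
orthonormal bases. -/
lemma sum_orthogonal_eq [FiniteDimensional ℂ V] (hV : finrank ℂ V = 3) {f : V → ℝ} {W : ℝ}
    (hsmul : ∀ (c : ℂ) x, c ≠ 0 → f (c • x) = f x)
    (hsum : ∀ b : OrthonormalBasis (Fin 3) ℂ V, f (b 0) + f (b 1) + f (b 2) = W)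
    {x y z : V} (hx : x ≠ 0) (hy : y ≠ 0) (hz : z ≠ 0) (hxy : ⟪x, y⟫_ℂ = 0)
    (hxz : ⟪x, z⟫_ℂ = 0) (hyz : ⟪y, z⟫_ℂ = 0) : f x + f y + f z = W := by
  have hn {x : V} (hx : x ≠ 0) : ((‖x‖ : ℂ))⁻¹ ≠ 0 := by simpa using hx
  have hn' {x : V} (hx : x ≠ 0) : ‖((‖x‖ : ℂ))⁻¹ • x‖ = 1 := by
    rw [norm_smul, norm_inv, Complex.norm_real, norm_norm, inv_mul_cancel₀ (by simpa using hx)]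
  let v : Fin 3 → V := ![((‖x‖ : ℂ))⁻¹ • x, ((‖y‖ : ℂ))⁻¹ • y, ((‖z‖ : ℂ))⁻¹ • z]
  have hv : Orthonormal ℂ (Set.univ.domRestrict v) := by
    refine Orthonormal.comp (v := v) ⟨?_, ?_⟩ Subtype.val Subtype.val_injective
    · intro i; fin_cases i <;> simp only [v]
      exacts [hn' hx, hn' hy, hn' hz]
    · intro i j hij
      have hyx := inner_eq_zero_symm.1 hxy
      have hzx := inner_eq_zero_symm.1 hxz
      have hzy := inner_eq_zero_symm.1 hyz
      fin_cases i <;> fin_cases j <;>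
        simp_all [v, inner_smul_left, inner_smul_right]
  obtain ⟨b, hb⟩ := hv.exists_orthonormalBasis_extension_of_card_eq (by simp [hV])
  have := hsum b
  simp only [hb _ (Set.mem_univ _)] at this
  simpa [v, hsmul _ _ (hn hx), hsmul _ _ (hn hy), hsmul _ _ (hn hz)] using this

variable [MeasurableSpace V] [BorelSpace V]

lemma measurable_coordEquiv (b : OrthonormalBasis (Fin 3) ℂ V) : Measurable (coordEquiv b) :=
  (coordEquiv b : (ℂ × (ℂ × ℂ)) →ₗ[ℂ] V).continuous_of_finiteDimensional.measurable

/-- This makes the measure on `V` independent of the basis, so that the moment formula can be proved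
in coordinates adapted to each unit vector and still refer to one fixed measure. -/
lemma map_coordEquiv_volume (b b' : OrthonormalBasis (Fin 3) ℂ V) :
    Measure.map (coordEquiv b) volume = Measure.map (coordEquiv b') volume := by
  have h := map_volume_of_isometry ((coordEquiv b).trans (coordEquiv b').symm) fun z => by
    rw [← norm_sq_coordEquiv b', ← norm_sq_coordEquiv b]; simp
  have hc : Continuous ((coordEquiv b).trans (coordEquiv b').symm).toLinearMap :=
    LinearMap.continuous_of_finiteDimensional _
  have hm : Measurable ((coordEquiv b).trans (coordEquiv b').symm) := hc.measurable
  conv_rhs => rw [← h]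
  rw [Measure.map_map (measurable_coordEquiv b') hm]
  congr 1
  ext z
  simp

/-- A bounded measurable frame function on a three-dimensional space, multiplied by the constant
`ballMoment 1`, is given by the second moments of its restriction to the unit ball. -/
lemma frameFunction_eq_moment [FiniteDimensional ℂ V] (hV : finrank ℂ V = 3) {f : V → ℝ} {W : ℝ}
    (hm : Measurable f) (h0 : ∀ x, 0 ≤ f x)
    (hsmul : ∀ (c : ℂ) x, c ≠ 0 → f (c • x) = f x)
    (hsum : ∀ b : OrthonormalBasis (Fin 3) ℂ V, f (b 0) + f (b 1) + f (b 2) = W)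
    (b : OrthonormalBasis (Fin 3) ℂ V) {u : V} (hu : ‖u‖ = 1) :
    ballMoment 1 * (ENNReal.ofReal (f u) + ENNReal.ofReal W) =
      4 * ∫⁻ x in Metric.closedBall 0 1, ENNReal.ofReal (f x * ‖⟪u, x⟫_ℂ‖ ^ 2)
        ∂(Measure.map (coordEquiv b) volume) := by
  have hu' : Orthonormal ℂ (({0} : Set (Fin 3)).domRestrict fun _ => u) := by
    refine ⟨fun _ => hu, fun i j hij => absurd (Subsingleton.elim i j) hij⟩
  -- In a basis starting with `u`, the first coordinate of `x` is `⟪u, x⟫`.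
  obtain ⟨b', hb'⟩ := hu'.exists_orthonormalBasis_extension_of_card_eq (by simp [hV])
  have hbu : b' 0 = u := hb' 0 rfl
  have hinj {z : ℂ × (ℂ × ℂ)} (hz : z ≠ 0) : coordEquiv b' z ≠ 0 := by simpa using hz
  have htriple {z₁ z₂ z₃ : ℂ × (ℂ × ℂ)} (hz₁ : z₁ ≠ 0) (hz₂ : z₂ ≠ 0) (hz₃ : z₃ ≠ 0)
      (h₁₂ : conj z₁.1 * z₂.1 + conj z₁.2.1 * z₂.2.1 + conj z₁.2.2 * z₂.2.2 = 0)
      (h₁₃ : conj z₁.1 * z₃.1 + conj z₁.2.1 * z₃.2.1 + conj z₁.2.2 * z₃.2.2 = 0)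
      (h₂₃ : conj z₂.1 * z₃.1 + conj z₂.2.1 * z₃.2.1 + conj z₂.2.2 * z₃.2.2 = 0) :
      f (coordEquiv b' z₁) + f (coordEquiv b' z₂) + f (coordEquiv b' z₃) = W :=
    sum_orthogonal_eq hV hsmul hsum (hinj hz₁) (hinj hz₂) (hinj hz₃)
      (by rwa [inner_coordEquiv]) (by rwa [inner_coordEquiv]) (by rwa [inner_coordEquiv])
  have hturn {v : ℂ × ℂ} (hv : v ≠ 0) : ((0, (-conj v.2, conj v.1)) : ℂ × (ℂ × ℂ)) ≠ 0 := by
    contrapose! hv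
    simp only [Prod.mk_eq_zero, neg_eq_zero, map_eq_zero] at hv
    exact Prod.ext hv.2.2 hv.2.1
  have hbase {v : ℂ × ℂ} (hv : v ≠ 0) : f (coordEquiv b' (1, 0)) + f (coordEquiv b' (0, v)) +
      f (coordEquiv b' (0, (-conj v.2, conj v.1))) = W := by
    refine htriple (by simp) (by simpa using hv) (hturn hv) ?_ ?_ ?_
    · simp
    · simp
    · simp; ring
  set h : ℂ × (ℂ × ℂ) → ℝ≥0∞ := fun z => ENNReal.ofReal (f (coordEquiv b' z)) with hh
  have hhm : Measurable h := (hm.comp (measurable_coordEquiv b')).ennreal_ofReal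
  have key := ballMoment_one_mul (h := h) (W := ENNReal.ofReal W) hhm
    (fun c z hc => by simp only [hh, map_smul, hsmul c _ hc])
    (fun a b v hv ha hb => by
      have hv0 : v ≠ 0 := by rintro rfl; simp [sqNorm] at hv
      -- The same third vector completes this pair and the pair `(1, 0)`, `(0, v)`, so the two pair
      -- sums agree.
      have h1 : f (coordEquiv b' (a, b • v)) + f (coordEquiv b' (-conj b, conj a • v)) +
          f (coordEquiv b' (0, (-conj v.2, conj v.1))) = W := by
        refine htriple (by simp [ha]) (by simp [hb]) (hturn hv0) ?_ ?_ ?_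
        · have hv' : conj v.1 * v.1 + conj v.2 * v.2 = 1 := by
            rw [RCLike.conj_mul, RCLike.conj_mul]
            unfold sqNorm at hv
            simpa using congrArg (fun t : ℝ => (t : ℂ)) hv
          simp only [Prod.smul_fst, Prod.smul_snd, smul_eq_mul, map_mul]
          linear_combination conj a * conj b * hv'
        · simp; ring
        · simp; ring
      have h2 := hbase hv0
      simp only [hh]
      rw [← ENNReal.ofReal_add (h0 _) (h0 _), ← ENNReal.ofReal_add (h0 _) (h0 _)]
      congr 1
      linarith)
    (fun v hv => by
      simp only [hh]
      rw [← hbase hv, ENNReal.ofReal_add (add_nonneg (h0 _) (h0 _)) (h0 _),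
        ENNReal.ofReal_add (h0 _) (h0 _)])
  have hb10 : coordEquiv b' (1, 0) = u := by simp [coordEquiv_apply, hbu]
  rw [show h (1, 0) = ENNReal.ofReal (f u) by rw [← hb10]] at key
  rw [key, map_coordEquiv_volume b b', ballMoment,
    ← lintegral_indicator Metric.isClosed_closedBall.measurableSet,
    lintegral_map _ (measurable_coordEquiv b')]
  · congr 1
    refine lintegral_congr fun z => ?_
    have hz := norm_sq_coordEquiv b' z
    have hz1 : ⟪u, coordEquiv b' z⟫_ℂ = z.1 := by rw [← hbu, inner_zero_coordEquiv]
    by_cases hmem : ‖z.1‖ ^ 2 + sqNorm z.2 ∈ Set.Iic (1 : ℝ)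
    · have : coordEquiv b' z ∈ Metric.closedBall (0 : V) 1 := by
        rw [← hz, Set.mem_Iic] at hmem
        rw [mem_closedBall_zero_iff]
        nlinarith [norm_nonneg (coordEquiv b' z)]
      rw [Set.indicator_of_mem this, cutoff, Set.indicator_of_mem hmem, hz1,
        ENNReal.ofReal_mul (h0 _), Pi.one_apply, mul_one]
    · have : coordEquiv b' z ∉ Metric.closedBall (0 : V) 1 := by
        contrapose! hmem
        rw [mem_closedBall_zero_iff] at hmem
        rw [← hz, Set.mem_Iic]
        nlinarith [norm_nonneg (coordEquiv b' z)]
      rw [Set.indicator_of_notMem this, cutoff, Set.indicator_of_notMem hmem, mul_zero, mul_zero]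
  · refine Measurable.indicator ?_ Metric.isClosed_closedBall.measurableSet
    have : Continuous fun x : V => ⟪u, x⟫_ℂ := by fun_prop
    exact (hm.mul (this.measurable.norm.pow_const 2)).ennreal_ofReal

/-- **Gleason's theorem** for measurable frame functions in dimension three. -/
theorem exists_operator_of_frameFunction_three [FiniteDimensional ℂ V] (hV : finrank ℂ V = 3)
    {f : V → ℝ} {W : ℝ} (hm : Measurable f) (h0 : ∀ x, 0 ≤ f x) (h1 : ∀ x, f x ≤ 1)
    (hsmul : ∀ (c : ℂ) x, c ≠ 0 → f (c • x) = f x)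
    (hsum : ∀ b : OrthonormalBasis (Fin 3) ℂ V, f (b 0) + f (b 1) + f (b 2) = W) :
    ∃ T : V →ₗ[ℂ] V, ∀ u, ‖u‖ = 1 → (f u : ℂ) = ⟪u, T u⟫_ℂ := by
  let b : OrthonormalBasis (Fin 3) ℂ V := (stdOrthonormalBasis ℂ V).reindex (finCongr hV)
  have hW : 0 ≤ W := by
    rw [← hsum b]; linarith [h0 (b 0), h0 (b 1), h0 (b 2)]
  set ν : Measure V := (Measure.map (coordEquiv b) volume).restrict (Metric.closedBall 0 1) with hν
  have hνfin : IsFiniteMeasure ν := by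
    refine ⟨?_⟩
    rw [hν, Measure.restrict_apply_univ, Measure.map_apply (measurable_coordEquiv b)
      Metric.isClosed_closedBall.measurableSet]
    refine ne_top_of_le_ne_top (isCompact_closedBall (0 : ℂ × (ℂ × ℂ)) 1).measure_ne_top
      (measure_mono fun z hz => ?_) |>.lt_top
    rw [Set.mem_preimage, mem_closedBall_zero_iff] at hz
    have hz' := norm_sq_coordEquiv b z
    unfold sqNorm at hz'
    rw [mem_closedBall_zero_iff]
    refine norm_prod_le_iff.2 ⟨?_, norm_prod_le_iff.2 ⟨?_, ?_⟩⟩ <;>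
      nlinarith [sq_nonneg ‖z.1‖, sq_nonneg ‖z.2.1‖, sq_nonneg ‖z.2.2‖,
        norm_nonneg (coordEquiv b z)]
  have hball : ∀ᵐ x ∂ν, ‖x‖ ≤ 1 := by
    filter_upwards [ae_restrict_mem Metric.isClosed_closedBall.measurableSet] with x hx
    simpa using hx
  have hcont : Continuous fun x : V => InnerProductSpace.rankOne ℂ x x := by
    refine continuous_clm_apply.2 fun y => ?_
    simp only [InnerProductSpace.rankOne_apply]
    fun_prop
  have hint : Integrable (fun x => (f x : ℂ) • InnerProductSpace.rankOne ℂ x x) ν := by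
    refine Integrable.of_bound
      ((Complex.measurable_ofReal.comp hm).aestronglyMeasurable.smul
        hcont.aestronglyMeasurable) 1 ?_
    filter_upwards [hball] with x hx
    rw [norm_smul, InnerProductSpace.norm_rankOne, Complex.norm_real, Real.norm_eq_abs,
      abs_of_nonneg (h0 x)]
    nlinarith [h0 x, h1 x, norm_nonneg x, mul_nonneg (norm_nonneg x) (norm_nonneg x)]
  -- The second moments of `f` are the values of the quadratic form of `∫ f(x) |x⟩⟨x| dν`.
  set T₀ : V →L[ℂ] V := ∫ x, (f x : ℂ) • InnerProductSpace.rankOne ℂ x x ∂ν with hT₀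
  have hT₀u (u : V) : ⟪u, T₀ u⟫_ℂ = ((∫ x, f x * ‖⟪u, x⟫_ℂ‖ ^ 2 ∂ν : ℝ) : ℂ) := by
    have h2 := ContinuousLinearMap.integral_comp_comm
      ((innerSL ℂ u).comp (ContinuousLinearMap.apply ℂ V u)) hint
    have h3 : ⟪u, T₀ u⟫_ℂ = ((innerSL ℂ u).comp (ContinuousLinearMap.apply ℂ V u)) T₀ := by simp
    rw [h3, hT₀, ← h2, ← integral_complex_ofReal]
    refine integral_congr_ae (ae_of_all _ fun x => ?_)
    simp only [ContinuousLinearMap.comp_apply, ContinuousLinearMap.apply_apply,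
      smul_apply, InnerProductSpace.rankOne_apply, innerSL_apply_apply,
      inner_smul_right]
    rw [← inner_conj_symm x u, RCLike.conj_mul]
    push_cast
    rfl
  set A : ℝ := (ballMoment 1).toReal with hA
  have hApos : 0 < A := ENNReal.toReal_pos ballMoment_one_ne_zero ballMoment_one_ne_top
  have hmom (u : V) (hu : ‖u‖ = 1) : A * (f u + W) = 4 * ∫ x, f x * ‖⟪u, x⟫_ℂ‖ ^ 2 ∂ν := by
    have h2 := congrArg ENNReal.toReal (frameFunction_eq_moment hV hm h0 hsmul hsum b hu)
    rw [ENNReal.toReal_mul, ← ENNReal.ofReal_add (h0 u) hW,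
      ENNReal.toReal_ofReal (add_nonneg (h0 u) hW), ENNReal.toReal_mul] at h2
    have hc : Continuous fun x : V => ⟪u, x⟫_ℂ := by fun_prop
    rw [hA, h2, integral_eq_lintegral_of_nonneg_ae
      (ae_of_all _ fun x => mul_nonneg (h0 x) (sq_nonneg _))
      (hm.mul (hc.measurable.norm.pow_const 2)).aestronglyMeasurable]
    rfl
  -- This is `A (f u + W) = 4 ⟪u, T₀ u⟫` solved for `f u`; on unit vectors the constant `W` is the
  -- form of `W • id`.
  refine ⟨((4 / A : ℝ) : ℂ) • (T₀ : V →ₗ[ℂ] V) - (W : ℂ) • LinearMap.id, fun u hu => ?_⟩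
  have hfu : f u = 4 / A * (∫ x, f x * ‖⟪u, x⟫_ℂ‖ ^ 2 ∂ν) - W := by
    field_simp
    linarith [hmom u hu]
  simp only [LinearMap.sub_apply, LinearMap.smul_apply, LinearMap.id_apply, inner_sub_right,
    inner_smul_right, ContinuousLinearMap.coe_coe, hT₀u, inner_self_eq_norm_sq_to_K, hu]
  rw [hfu]
  push_cast
  ring

end DimensionThree

end GeometricQM

end

noncomputable section

namespace GeometricQM

/-! ### Gleason's theorem for measurable frame functions -/

section Gleason

open scoped ComplexConjugate

lemma exists_finrank_eq_of_le {K V : Type*} [Field K] [AddCommGroup V] [Module K V]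
    [FiniteDimensional K V] {n : ℕ} (hn : n ≤ finrank K V) (S : Submodule K V)
    (hS : finrank K S ≤ n) : ∃ T : Submodule K V, S ≤ T ∧ finrank K T = n := by
  obtain ⟨k, hk⟩ := Nat.exists_eq_add_of_le hS
  induction k generalizing S with
  | zero => exact ⟨S, le_rfl, by omega⟩
  | succ k ih =>
    obtain ⟨v, -, hv⟩ : ∃ v ∈ (⊤ : Submodule K V), v ∉ S := by
      refine SetLike.exists_of_lt (lt_top_iff_ne_top.2 ?_)
      rintro rfl
      rw [finrank_top] at hk
      omega
    have h1 := Submodule.finrank_sup_span_singleton hv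
    obtain ⟨T, hT, hT'⟩ := ih (S ⊔ K ∙ v) (by omega) (by omega)
    exact ⟨T, le_sup_left.trans hT, hT'⟩

variable {H : Type*} [NormedAddCommGroup H] [InnerProductSpace ℂ H]

open Classical in
/-- A function on the projective space as a function of representatives. -/
def onVectors (ρ : ℙ ℂ H → ℝ) (x : H) : ℝ :=
  if h : x ≠ 0 then ρ (Projectivization.mk ℂ x h) else 0

lemma onVectors_of_ne_zero (ρ : ℙ ℂ H → ℝ) {x : H} (hx : x ≠ 0) :
    onVectors ρ x = ρ (Projectivization.mk ℂ x hx) := dif_pos hx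

lemma onVectors_smul (ρ : ℙ ℂ H → ℝ) {c : ℂ} (hc : c ≠ 0) (x : H) :
    onVectors ρ (c • x) = onVectors ρ x := by
  by_cases hx : x = 0
  · simp [hx]
  · rw [onVectors_of_ne_zero ρ hx, onVectors_of_ne_zero ρ (smul_ne_zero hc hx)]
    congr 1
    rw [Projectivization.mk_eq_mk_iff']
    exact ⟨c, rfl⟩

lemma measurable_onVectors [MeasurableSpace H] [BorelSpace H] {ρ : ℙ ℂ H → ℝ}
    (hρ : Measurable ρ) : Measurable (onVectors ρ) := by
  classical
  refine Measurable.dite (s := {x : H | x ≠ 0}) (f := ρ ∘ Projectivization.mk' ℂ)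
    (g := fun _ => 0) (hρ.comp ?_) measurable_const (measurableSet_singleton (0 : H)).compl
  exact continuous_mk'.measurable

lemma onVectors_mem_Icc {ρ : ℙ ℂ H → ℝ} (hρ : ∀ p, ρ p ∈ Set.Icc (0 : ℝ) 1) (x : H) :
    onVectors ρ x ∈ Set.Icc (0 : ℝ) 1 := by
  by_cases hx : x = 0
  · simp [onVectors, hx]
  · rw [onVectors_of_ne_zero ρ hx]; exact hρ _

lemma isFrame_of_orthonormal {v : Fin (finrank ℂ H) → H} (hv : Orthonormal ℂ v) :
    IsFrame fun i => Projectivization.mk ℂ (v i) (hv.ne_zero i) := fun _ _ hij =>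
  (fubiniStudyDist_mk_eq_pi_div_two_iff _ _).2 (hv.2 hij)

lemma IsFrameFunction.exists_sum_onVectors {ρ : ℙ ℂ H → ℝ}
    (hρ : IsFrameFunction fun p => (ρ p : ℂ)) :
    ∃ W : ℝ, ∀ v : Fin (finrank ℂ H) → H, Orthonormal ℂ v → ∑ i, onVectors ρ (v i) = W := by
  obtain ⟨W, hW⟩ := hρ
  refine ⟨W.re, fun v hv => ?_⟩
  have := hW _ (isFrame_of_orthonormal hv)
  rw [← this]
  simp [onVectors_of_ne_zero ρ (hv.ne_zero _)]

variable [FiniteDimensional ℂ H]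

/-- The restriction of a frame function to a three-dimensional subspace is a frame function. -/
lemma exists_sum_onVectors_subspace {ρ : ℙ ℂ H → ℝ}
    (hρ : IsFrameFunction fun p => (ρ p : ℂ)) {V : Submodule ℂ H} (hV : finrank ℂ V = 3) :
    ∃ W : ℝ, ∀ b : OrthonormalBasis (Fin 3) ℂ V,
      onVectors ρ (b 0) + onVectors ρ (b 1) + onVectors ρ (b 2) = W := by
  obtain ⟨W, hW⟩ := hρ.exists_sum_onVectors
  -- One fixed basis of `Vᗮ` completes every orthonormal basis of `V`, so its contribution to the
  -- frame sum is constant.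
  let c := stdOrthonormalBasis ℂ Vᗮ
  refine ⟨W - ∑ j, onVectors ρ (c j), fun b => ?_⟩
  have hcard : finrank ℂ H = Fintype.card (Fin 3 ⊕ Fin (finrank ℂ Vᗮ)) := by
    simp [← V.finrank_add_finrank_orthogonal, hV]
  let e : Fin (finrank ℂ H) ≃ Fin 3 ⊕ Fin (finrank ℂ Vᗮ) :=
    Fintype.equivOfCardEq (by simpa using hcard)
  let v : Fin 3 ⊕ Fin (finrank ℂ Vᗮ) → H := Sum.elim (fun i => (b i : H)) (fun j => (c j : H))
  have hb : Orthonormal ℂ fun i => (b i : H) := b.orthonormal.comp_linearIsometry V.subtypeₗᵢ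
  have hc : Orthonormal ℂ fun i => (c i : H) := c.orthonormal.comp_linearIsometry Vᗮ.subtypeₗᵢ
  have hv : Orthonormal ℂ v := by
    refine ⟨?_, ?_⟩
    · rintro (i | j)
      exacts [hb.1 i, hc.1 j]
    · rintro (i | j) (i' | j') hij
      · exact hb.2 (by simpa using hij)
      · exact V.inner_right_of_mem_orthogonal (b i).2 (c j').2
      · exact V.inner_left_of_mem_orthogonal (b i').2 (c j).2
      · exact hc.2 (by simpa using hij)
  have h1 := hW (v ∘ e) (hv.comp _ e.injective)
  have h2 : ∑ i, onVectors ρ ((v ∘ e) i) = ∑ i, onVectors ρ (v i) :=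
    e.sum_comp fun i => onVectors ρ (v i)
  rw [h2, Fintype.sum_sum_type, Fin.sum_univ_three] at h1
  simp only [v, Sum.elim_inl, Sum.elim_inr] at h1
  linarith

/-- The function `x ↦ ‖x‖² ρ([x])`. -/
def quadratic (ρ : ℙ ℂ H → ℝ) (x : H) : ℂ := ((‖x‖ ^ 2 * onVectors ρ x : ℝ) : ℂ)

/-- On every three-dimensional subspace, `‖x‖² ρ([x])` is a quadratic form. -/
lemma exists_quadratic_eq_inner {ρ : ℙ ℂ H → ℝ} (hm : Measurable ρ)
    (h01 : ∀ p, ρ p ∈ Set.Icc (0 : ℝ) 1) (hρ : IsFrameFunction fun p => (ρ p : ℂ))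
    {V : Submodule ℂ H} (hV : finrank ℂ V = 3) :
    ∃ T : H →ₗ[ℂ] H, ∀ x ∈ V, quadratic ρ x = ⟪T x, x⟫_ℂ := by
  let _ : MeasurableSpace H := borel H
  have _ : BorelSpace H := ⟨rfl⟩
  obtain ⟨W, hW⟩ := exists_sum_onVectors_subspace hρ hV
  obtain ⟨T, hT⟩ := exists_operator_of_frameFunction_three hV
    (f := fun x : V => onVectors ρ (x : H)) (W := W)
    ((measurable_onVectors hm).comp measurable_subtype_coe)
    (fun x => (onVectors_mem_Icc h01 _).1) (fun x => (onVectors_mem_Icc h01 _).2)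
    (fun c x hc => onVectors_smul ρ hc _) hW
  refine ⟨V.subtype ∘ₗ T ∘ₗ (V.orthogonalProjectionOnto : H →ₗ[ℂ] V), fun x hx => ?_⟩
  have hPx : V.orthogonalProjectionOnto x = ⟨x, hx⟩ :=
    Submodule.orthogonalProjectionOnto_mem_subspace_eq_self (K := V) ⟨x, hx⟩
  by_cases hx0 : x = 0
  · simp [hx0, quadratic]
  have hn : ‖x‖ ≠ 0 := norm_ne_zero_iff.2 hx0
  have hnC : (‖x‖ : ℂ) ≠ 0 := by exact_mod_cast hn
  have h1 := hT ((‖x‖ : ℂ)⁻¹ • ⟨x, hx⟩) (by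
    rw [norm_smul, norm_inv, Complex.norm_real, norm_norm]
    exact inv_mul_cancel₀ hn)
  rw [Submodule.coe_smul, onVectors_smul ρ (inv_ne_zero hnC), map_smul, inner_smul_left,
    inner_smul_right] at h1
  simp only [map_inv₀, Complex.conj_ofReal, ← mul_assoc] at h1
  have h2 : quadratic ρ x = ⟪(⟨x, hx⟩ : V), T ⟨x, hx⟩⟫_ℂ := by
    rw [quadratic]
    push_cast
    rw [h1]
    field_simp
  -- The form is real, so the operator may move to the first slot, where `inner_map_polarization'`
  -- expects it.
  have h3 : conj (quadratic ρ x) = quadratic ρ x := Complex.conj_ofReal _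
  rw [← h3, h2, inner_conj_symm]
  simp [hPx]

/-- **Gleason's theorem** for measurable frame functions with values in `[0, 1]`. -/
theorem exists_operator_of_isFrameFunction (hH : 2 < finrank ℂ H) {ρ : ℙ ℂ H → ℝ}
    (hm : Measurable ρ) (h01 : ∀ p, ρ p ∈ Set.Icc (0 : ℝ) 1)
    (hρ : IsFrameFunction fun p => (ρ p : ℂ)) :
    ∃ T : H →ₗ[ℂ] H, ∀ x, quadratic ρ x = ⟪x, T x⟫_ℂ := by
  let B : H → H → ℂ := fun x y =>
    (quadratic ρ (x + y) - quadratic ρ (x - y) - Complex.I * quadratic ρ (x + Complex.I • y) +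
      Complex.I * quadratic ρ (x - Complex.I • y)) / 4
  -- The operator `T` may depend on the subspace, but `B` does not: three vectors at a time, `B`
  -- inherits the laws of a sesquilinear form from `⟪T u, v⟫`.
  have hB (x y z : H) : ∃ (T : H →ₗ[ℂ] H) (V : Submodule ℂ H), x ∈ V ∧ y ∈ V ∧ z ∈ V ∧
      ∀ u ∈ V, ∀ v ∈ V, B u v = ⟪T u, v⟫_ℂ := by
    classical
    obtain ⟨V, hle, hV⟩ := exists_finrank_eq_of_le (n := 3) hH
      (Submodule.span ℂ (({x, y, z} : Finset H) : Set H))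
      ((finrank_span_finset_le_card _).trans Finset.card_le_three)
    obtain ⟨T, hT⟩ := exists_quadratic_eq_inner hm h01 hρ hV
    have hmem {u : H} (hu : u ∈ ({x, y, z} : Finset H)) : u ∈ V :=
      hle (Submodule.subset_span hu)
    refine ⟨T, V, hmem (by simp), hmem (by simp), hmem (by simp), fun u hu v hv => ?_⟩
    have hIv := V.smul_mem Complex.I hv
    simp only [B]
    rw [hT _ (V.add_mem hu hv), hT _ (V.sub_mem hu hv), hT _ (V.add_mem hu hIv),
      hT _ (V.sub_mem hu hIv), ← inner_map_polarization']
  let L : H →ₗ⋆[ℂ] H →ₗ[ℂ] ℂ := LinearMap.mk₂'ₛₗ (starRingEnd ℂ) (RingHom.id ℂ) B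
    (fun x x' y => by
      obtain ⟨T, V, hx, hx', hy, h⟩ := hB x x' y
      rw [h _ (V.add_mem hx hx') _ hy, h _ hx _ hy, h _ hx' _ hy, map_add, inner_add_left])
    (fun c x y => by
      obtain ⟨T, V, hx, -, hy, h⟩ := hB x x y
      rw [h _ (V.smul_mem c hx) _ hy, h _ hx _ hy, map_smul, inner_smul_left, smul_eq_mul])
    (fun x y y' => by
      obtain ⟨T, V, hx, hy, hy', h⟩ := hB x y y'
      rw [h _ hx _ (V.add_mem hy hy'), h _ hx _ hy, h _ hx _ hy', inner_add_right])
    (fun c x y => by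
      obtain ⟨T, V, hx, -, hy, h⟩ := hB x x y
      rw [h _ hx _ (V.smul_mem c hy), h _ hx _ hy, inner_smul_right]; rfl)
  have hL (x : H) : L x x = quadratic ρ x := by
    obtain ⟨V, hle, hV⟩ := exists_finrank_eq_of_le (n := 3) hH (Submodule.span ℂ {x})
      ((finrank_span_le_card _).trans (by simp))
    obtain ⟨T, hT⟩ := exists_quadratic_eq_inner hm h01 hρ hV
    have hx : x ∈ V := hle (Submodule.mem_span_singleton_self x)
    have hIx := V.smul_mem Complex.I hx
    change B x x = _
    simp only [B]
    rw [hT _ (V.add_mem hx hx), hT _ (V.sub_mem hx hx), hT _ (V.add_mem hx hIx),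
      hT _ (V.sub_mem hx hIx), ← inner_map_polarization', hT x hx]
  let e := stdOrthonormalBasis ℂ H
  -- The operator is chosen so that `⟪e i, T x⟫ = L (e i) x`.
  refine ⟨∑ i, (L (e i)).smulRight (e i), fun x => ?_⟩
  rw [← hL x]
  conv_lhs => enter [1]; rw [← e.sum_repr' x]
  simp only [map_sum, LinearMap.map_smulₛₗ, LinearMap.sum_apply, LinearMap.smul_apply,
    LinearMap.smulRight_apply, inner_sum, inner_smul_right, smul_eq_mul, inner_conj_symm]
  exact Finset.sum_congr rfl fun i _ => mul_comm _ _

end Gleason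

end GeometricQM

end

noncomputable section

namespace GeometricQM

/-! ### Density matrices and Liouville densities -/

section Density

open scoped ComplexConjugate

variable {H : Type*} [NormedAddCommGroup H] [InnerProductSpace ℂ H]

lemma smul_normalize {x : H} (hx : x ≠ 0) :
    (‖x‖ : ℂ) • (‖x‖ : ℂ)⁻¹ • x = x ∧ ‖(‖x‖ : ℂ)⁻¹ • x‖ = 1 := by
  refine ⟨smul_inv_smul₀ (by simpa using hx) _, ?_⟩
  rw [norm_smul, norm_inv, Complex.norm_real, norm_norm, inv_mul_cancel₀ (norm_ne_zero_iff.2 hx)]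

lemma inner_sub_apply_smul {σ τ : H →ₗ[ℂ] H} {z : H} (h : ⟪z, σ z⟫_ℂ = ⟪z, τ z⟫_ℂ) (c : ℂ) :
    ⟪(σ - τ) (c • z), c • z⟫_ℂ = 0 := by
  rw [← inner_conj_symm, map_smul, inner_smul_left, inner_smul_right, LinearMap.sub_apply,
    inner_sub_right, h, sub_self, mul_zero, mul_zero, map_zero]

lemma exists_unit_representative (p : ℙ ℂ H) :
    ∃ (x : H) (hx : x ≠ 0), ‖x‖ = 1 ∧ p = Projectivization.mk ℂ x hx := by
  have hn : (‖p.rep‖ : ℂ)⁻¹ ≠ 0 := by simpa using p.rep_nonzero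
  refine ⟨(‖p.rep‖ : ℂ)⁻¹ • p.rep, smul_ne_zero hn p.rep_nonzero,
    (smul_normalize p.rep_nonzero).2, ?_⟩
  conv_lhs => rw [← p.mk_rep]
  rw [Projectivization.mk_eq_mk_iff']
  exact ⟨(‖p.rep‖ : ℂ), (smul_normalize p.rep_nonzero).1⟩

/-- The expectation value of `σ` at a point of the projective space. -/
def expectation (σ : H →ₗ[ℂ] H) (p : ℙ ℂ H) : ℝ :=
  (⟪p.rep, σ p.rep⟫_ℂ).re / ‖p.rep‖ ^ 2

lemma expectation_mk (σ : H →ₗ[ℂ] H) {x : H} (hx : x ≠ 0) :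
    expectation σ (Projectivization.mk ℂ x hx) = (⟪x, σ x⟫_ℂ).re / ‖x‖ ^ 2 := by
  obtain ⟨a, ha⟩ := Projectivization.exists_smul_eq_mk_rep ℂ x hx
  have ha0 : ‖(a : ℂ)‖ ^ 2 ≠ 0 := by simp
  have h : ⟪(a : ℂ) • x, σ ((a : ℂ) • x)⟫_ℂ = ((‖(a : ℂ)‖ ^ 2 : ℝ) : ℂ) * ⟪x, σ x⟫_ℂ := by
    rw [map_smul, inner_smul_left, inner_smul_right, ← mul_assoc, RCLike.conj_mul]
    push_cast; rfl
  rw [expectation, ← ha, Units.smul_def, h, Complex.re_ofReal_mul, norm_smul, mul_pow,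
    mul_div_mul_left _ _ ha0]

variable [FiniteDimensional ℂ H]

lemma Describes.apply_mk {ρ : ℙ ℂ H → ℝ} {σ : H →ₗ[ℂ] H} (h : Describes ρ σ) {x : H}
    (hx : x ≠ 0) (hx1 : ‖x‖ = 1) : (ρ (Projectivization.mk ℂ x hx) : ℂ) = ⟪x, σ x⟫_ℂ := by
  rw [h, trace_comp_projector_mk σ hx hx1]

lemma describes_of_forall_unit {ρ : ℙ ℂ H → ℝ} {σ : H →ₗ[ℂ] H}
    (h : ∀ (x : H) (hx : x ≠ 0), ‖x‖ = 1 → (ρ (Projectivization.mk ℂ x hx) : ℂ) = ⟪x, σ x⟫_ℂ) :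
    Describes ρ σ := by
  intro p
  obtain ⟨x, hx, hx1, rfl⟩ := exists_unit_representative p
  rw [h x hx hx1, trace_comp_projector_mk σ hx hx1]

lemma Describes.eq_expectation {ρ : ℙ ℂ H → ℝ} {σ : H →ₗ[ℂ] H} (h : Describes ρ σ) :
    ρ = expectation σ := by
  ext p
  obtain ⟨x, hx, hx1, rfl⟩ := exists_unit_representative p
  rw [expectation_mk, ← h.apply_mk hx hx1, hx1]
  simp

lemma describes_expectation {σ : H →ₗ[ℂ] H} (hσ : σ.IsSymmetric) :
    Describes (expectation σ) σ := by
  refine describes_of_forall_unit fun x hx hx1 => ?_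
  rw [expectation_mk, hx1, one_pow, div_one]
  exact Complex.conj_eq_iff_re.1 (by rw [inner_conj_symm]; exact hσ x x)

lemma continuous_expectation (σ : H →ₗ[ℂ] H) : Continuous (expectation σ) := by
  refine continuous_coinduced_dom.2 ?_
  have hσ : Continuous σ := σ.continuous_of_finiteDimensional
  have h : expectation σ ∘ Projectivization.mk' ℂ =
      fun x : {x : H // x ≠ 0} => (⟪x.1, σ x.1⟫_ℂ).re / ‖x.1‖ ^ 2 := by
    ext x; exact expectation_mk σ x.2
  rw [h]
  refine Continuous.div (by fun_prop) (by fun_prop) fun x => ?_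
  simpa using x.2

instance isFiniteMeasure_liouvilleMeasure : IsFiniteMeasure (liouvilleMeasure H) :=
  ⟨by rw [liouvilleMeasure_univ]; exact ENNReal.natCast_lt_top _⟩

lemma integrable_expectation (σ : H →ₗ[ℂ] H) :
    Integrable (expectation σ) (liouvilleMeasure H) := by
  refine Integrable.of_bound (continuous_expectation σ).measurable.aestronglyMeasurable
    ‖LinearMap.toContinuousLinearMap σ‖ (ae_of_all _ fun p => ?_)
  obtain ⟨x, hx, hx1, rfl⟩ := exists_unit_representative p
  rw [expectation_mk, hx1, one_pow, div_one, Real.norm_eq_abs]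
  calc |(⟪x, σ x⟫_ℂ).re| ≤ ‖⟪x, σ x⟫_ℂ‖ := Complex.abs_re_le_norm _
    _ ≤ ‖x‖ * ‖σ x‖ := norm_inner_le_norm _ _
    _ ≤ _ := by
      have := (LinearMap.toContinuousLinearMap σ).le_opNorm x
      rw [hx1, mul_one] at this
      simpa [hx1] using this

/-- The integral of the transition probability to a fixed vector of an orthonormal basis. -/
lemma integral_expectation_rankOne {ι : Type*} [Fintype ι] (e : OrthonormalBasis ι ℂ H) (i : ι) :
    ∫ p, expectation (InnerProductSpace.rankOne ℂ (e i) (e i) : H →ₗ[ℂ] H) p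
      ∂(liouvilleMeasure H) = 1 := by
  classical
  set P : ι → H →ₗ[ℂ] H := fun i => (InnerProductSpace.rankOne ℂ (e i) (e i) : H →L[ℂ] H)
  have hval (j : ι) {x : H} (hx : x ≠ 0) :
      expectation (P j) (Projectivization.mk ℂ x hx) = ‖⟪e j, x⟫_ℂ‖ ^ 2 / ‖x‖ ^ 2 := by
    rw [expectation_mk]
    simp only [P, ContinuousLinearMap.coe_coe, InnerProductSpace.rankOne_apply, inner_smul_right]
    rw [← inner_conj_symm x (e j), RCLike.mul_conj, ← RCLike.ofReal_pow]
    rfl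
  -- A unitary exchanging `e i` and `e j` shows that all these integrals agree; by Parseval they add
  -- up to the total mass, the dimension.
  have heq (j : ι) : ∫ p, expectation (P j) p ∂(liouvilleMeasure H) =
      ∫ p, expectation (P i) p ∂(liouvilleMeasure H) := by
    let U : H ≃ₗᵢ[ℂ] H := e.equiv e (Equiv.swap i j)
    have hU (x : H) : ⟪e j, U x⟫_ℂ = ⟪e i, x⟫_ℂ := by
      have : U (e i) = e j := by simp [U]
      rw [← this, U.inner_map_map]
    have hcomp (p : ℙ ℂ H) : expectation (P j)
        (Projectivization.map (U.toLinearEquiv : H →ₗ[ℂ] H) U.injective p) =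
          expectation (P i) p := by
      induction p with
      | h x hx =>
        have hUx : U x ≠ 0 := by simpa using hx
        have : Projectivization.map (U.toLinearEquiv : H →ₗ[ℂ] H) U.injective
            (Projectivization.mk ℂ x hx) = Projectivization.mk ℂ (U x) hUx := rfl
        rw [this, hval, hval, hU, U.norm_map]
    have hUm : Measurable (Projectivization.map (U.toLinearEquiv : H →ₗ[ℂ] H) U.injective) := by
      refine Continuous.measurable (continuous_coinduced_dom.2 ?_)
      have hV : Continuous fun x : {x : H // x ≠ 0} =>
          (⟨U x.1, by simpa using x.2⟩ : {x : H // x ≠ 0}) :=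
        (U.continuous.comp continuous_subtype_val).subtype_mk _
      exact continuous_mk'.comp hV
    conv_lhs => rw [← liouvilleMeasure_map H U]
    rw [integral_map hUm.aemeasurable
      (continuous_expectation (P j)).measurable.aestronglyMeasurable]
    exact integral_congr_ae (ae_of_all _ hcomp)
  have hsum : ∑ j, ∫ p, expectation (P j) p ∂(liouvilleMeasure H) = finrank ℂ H := by
    rw [← integral_finsetSum _ fun j _ => integrable_expectation (P j)]
    have h1 (p : ℙ ℂ H) : ∑ j, expectation (P j) p = 1 := by
      induction p with
      | h x hx =>
        simp only [hval]
        rw [← Finset.sum_div, e.sum_sq_norm_inner_right, div_self]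
        simpa using hx
    simp [h1, Measure.real, liouvilleMeasure_univ]
  have hcard : Fintype.card ι = finrank ℂ H := (finrank_eq_card_basis e.toBasis).symm
  simp only [heq, Finset.sum_const, Finset.card_univ, nsmul_eq_mul, hcard] at hsum
  have hpos : (finrank ℂ H : ℝ) ≠ 0 := by
    rw [← hcard]
    exact_mod_cast (Fintype.card_pos_iff.2 ⟨i⟩).ne'
  exact mul_left_cancel₀ hpos (hsum.trans (mul_one _).symm)

lemma integral_expectation {σ : H →ₗ[ℂ] H} (hσ : σ.IsSymmetric) :
    ((∫ p, expectation σ p ∂(liouvilleMeasure H) : ℝ) : ℂ) = LinearMap.trace ℂ H σ := by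
  -- Diagonalisation reduces the claim to the rank-one projectors of an eigenbasis, each of integral
  -- 1.
  let e := hσ.eigenvectorBasis rfl
  let P : Fin (finrank ℂ H) → H →ₗ[ℂ] H :=
    fun i => (InnerProductSpace.rankOne ℂ (e i) (e i) : H →L[ℂ] H)
  have h1 (p : ℙ ℂ H) : expectation σ p = ∑ i, hσ.eigenvalues rfl i * expectation (P i) p := by
    have hσx (x : H) : σ x = ∑ i, (hσ.eigenvalues rfl i : ℂ) • P i x := by
      conv_lhs => rw [← e.sum_repr' x]
      simp only [map_sum, map_smul, e, hσ.apply_eigenvectorBasis]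
      exact Finset.sum_congr rfl fun i _ => smul_comm _ _ _
    simp only [expectation]
    rw [hσx, inner_sum, Complex.re_sum, Finset.sum_div]
    refine Finset.sum_congr rfl fun i _ => ?_
    rw [inner_smul_right, Complex.re_ofReal_mul, mul_div_assoc]
  simp only [h1]
  rw [integral_finsetSum _ fun i _ => (integrable_expectation (P i)).const_mul _]
  simp only [integral_const_mul, P, integral_expectation_rankOne e, mul_one]
  rw [hσ.trace_eq_sum_eigenvalues rfl]
  rfl

lemma Describes.integral {ρ : ℙ ℂ H → ℝ} {σ : H →ₗ[ℂ] H} (h : Describes ρ σ)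
    (hσ : σ.IsSymmetric) :
    ((∫ p, ρ p ∂(liouvilleMeasure H) : ℝ) : ℂ) = LinearMap.trace ℂ H σ := by
  rw [h.eq_expectation, integral_expectation hσ]

/-- A density matrix is described by a Liouville density. -/
lemma IsDensityMatrix.isLiouvilleDensity {σ : H →ₗ[ℂ] H} (hσ : IsDensityMatrix σ) :
    IsLiouvilleDensity (expectation σ) where
  measurable := (continuous_expectation σ).measurable
  mem_Icc p := by
    obtain ⟨x, hx, hx1, rfl⟩ := exists_unit_representative p
    rw [expectation_mk, hx1, one_pow, div_one]
    have hpos (y : H) : 0 ≤ (⟪y, σ y⟫_ℂ).re := by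
      have := hσ.1.2 y
      rwa [hσ.1.1] at this
    refine ⟨hpos x, ?_⟩
    -- In an orthonormal basis containing `x`, the value at `x` is one of the nonnegative terms
    -- whose sum is `tr σ = 1`.
    have hx' : Orthonormal ℂ (Subtype.val : ({x} : Set H) → H) :=
      ⟨fun i => by rw [Set.mem_singleton_iff.1 i.2, hx1],
        fun i j hij => absurd (Subsingleton.elim i j) hij⟩
    obtain ⟨u, b, hu, hb⟩ := hx'.exists_orthonormalBasis_extension
    have htr := congrArg Complex.re (LinearMap.trace_eq_sum_inner σ b)
    rw [hσ.2, Complex.re_sum, hb, Complex.one_re] at htr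
    rw [htr]
    exact Finset.single_le_sum (f := fun i : u => (⟪(i : H), σ i⟫_ℂ).re) (fun i _ => hpos i)
      (Finset.mem_univ ⟨x, hu (Set.mem_singleton x)⟩)
  frameFunction := by
    refine ⟨1, fun p hp => ?_⟩
    choose v hv hv1 hpv using fun i => exists_unit_representative (p i)
    have hvo : Orthonormal ℂ v := by
      refine ⟨hv1, fun i j hij => ?_⟩
      have := hp i j hij
      rwa [hpv i, hpv j, fubiniStudyDist_mk_eq_pi_div_two_iff] at this
    have hvo' : Orthonormal ℂ (Set.univ.domRestrict v) :=
      hvo.comp Subtype.val Subtype.val_injective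
    obtain ⟨b, hb⟩ := hvo'.exists_orthonormalBasis_extension_of_card_eq (by simp)
    rw [← hσ.2, LinearMap.trace_eq_sum_inner σ b]
    refine Finset.sum_congr rfl fun i _ => ?_
    rw [hb i (Set.mem_univ i), hpv i]
    exact (describes_expectation hσ.1.1).apply_mk (hv i) (hv1 i)
  integral_eq_one := by
    have := integral_expectation hσ.1.1
    rw [hσ.2] at this
    exact_mod_cast this

/-- Every Liouville density describes a density matrix. -/
theorem IsLiouvilleDensity.exists_describes (hH : 2 < finrank ℂ H) {ρ : ℙ ℂ H → ℝ}
    (hρ : IsLiouvilleDensity ρ) : ∃ σ : H →ₗ[ℂ] H, IsDensityMatrix σ ∧ Describes ρ σ := by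
  obtain ⟨T, hT⟩ := exists_operator_of_isFrameFunction hH hρ.measurable hρ.mem_Icc
    hρ.frameFunction
  have hT' (x : H) : ⟪T x, x⟫_ℂ = quadratic ρ x := by
    rw [← inner_conj_symm, ← hT x]
    exact Complex.conj_ofReal _
  have hsymm : T.IsSymmetric := by
    rw [LinearMap.isSymmetric_iff_inner_map_self_real]
    intro x
    rw [hT' x]
    exact Complex.conj_ofReal _
  have hdesc : Describes ρ T := by
    refine describes_of_forall_unit fun x hx hx1 => ?_
    rw [← hT x, quadratic, hx1, onVectors_of_ne_zero ρ hx]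
    simp
  refine ⟨T, ⟨⟨hsymm, fun x => ?_⟩, ?_⟩, hdesc⟩
  · rw [hT' x]
    exact mul_nonneg (sq_nonneg _) (onVectors_mem_Icc hρ.mem_Icc x).1
  -- Under the normalisation of the measure, integral one means trace one.
  · rw [← hdesc.integral hsymm, hρ.integral_eq_one, Complex.ofReal_one]

end Density

/-! ### Product vectors -/

section Product

variable {HA HB : Type*} [NormedAddCommGroup HA] [InnerProductSpace ℂ HA] [FiniteDimensional ℂ HA]
  [NormedAddCommGroup HB] [InnerProductSpace ℂ HB] [FiniteDimensional ℂ HB]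

/-- An operator on a tensor product is determined by its expectation values in product vectors. -/
lemma eq_of_inner_tmul_eq {σ τ : HA ⊗[ℂ] HB →ₗ[ℂ] HA ⊗[ℂ] HB}
    (h : ∀ (x : HA) (y : HB), ‖x‖ = 1 → ‖y‖ = 1 →
      ⟪x ⊗ₜ[ℂ] y, σ (x ⊗ₜ[ℂ] y)⟫_ℂ = ⟪x ⊗ₜ[ℂ] y, τ (x ⊗ₜ[ℂ] y)⟫_ℂ) : σ = τ := by
  rw [← sub_eq_zero]
  set D := σ - τ with hD
  have h0 (x : HA) (y : HB) : ⟪D (x ⊗ₜ[ℂ] y), x ⊗ₜ[ℂ] y⟫_ℂ = 0 := by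
    by_cases hx : x = 0
    · simp [hx]
    by_cases hy : y = 0
    · simp [hy]
    have hz := inner_sub_apply_smul (h _ _ (smul_normalize hx).2 (smul_normalize hy).2)
      ((‖x‖ : ℂ) * ‖y‖)
    rw [← TensorProduct.smul_tmul_smul, (smul_normalize hx).1, (smul_normalize hy).1] at hz
    exact hz
  -- Over `ℂ` an operator with vanishing quadratic form is zero. Applied to compressions of `D`,
  -- this frees the second factor, and then the first.
  have h1 (x : HA) (y y' : HB) : ⟪D (x ⊗ₜ[ℂ] y), x ⊗ₜ[ℂ] y'⟫_ℂ = 0 := by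
    let T : HB →ₗ[ℂ] HA ⊗[ℂ] HB := TensorProduct.mk ℂ HA HB x
    have hA : LinearMap.adjoint T ∘ₗ D ∘ₗ T = 0 := (inner_map_self_eq_zero _).1 fun z => by
      simpa [T, LinearMap.adjoint_inner_left] using h0 x z
    have := congrArg (fun A : HB →ₗ[ℂ] HB => ⟪A y, y'⟫_ℂ) hA
    simpa [T, LinearMap.adjoint_inner_left] using this
  have h2 (x x' : HA) (y y' : HB) : ⟪D (x ⊗ₜ[ℂ] y), x' ⊗ₜ[ℂ] y'⟫_ℂ = 0 := by
    let T (y : HB) : HA →ₗ[ℂ] HA ⊗[ℂ] HB := (TensorProduct.mk ℂ HA HB).flip y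
    have hA : LinearMap.adjoint (T y') ∘ₗ D ∘ₗ T y = 0 :=
      (inner_map_self_eq_zero _).1 fun z => by
        simpa [T, LinearMap.adjoint_inner_left] using h1 z y y'
    have := congrArg (fun A : HA →ₗ[ℂ] HA => ⟪A x, x'⟫_ℂ) hA
    simpa [T, LinearMap.adjoint_inner_left] using this
  refine TensorProduct.ext' fun x y => ?_
  refine ext_inner_right ℂ fun w => ?_
  rw [LinearMap.zero_apply, inner_zero_left]
  induction w with
  | zero => simp
  | tmul x' y' => exact h2 x x' y y'
  | add w w' hw hw' => rw [inner_add_right, hw, hw', add_zero]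

lemma Describes.segre_mk {ρ : ℙ ℂ (HA ⊗[ℂ] HB) → ℝ} {σ : HA ⊗[ℂ] HB →ₗ[ℂ] HA ⊗[ℂ] HB}
    (h : Describes ρ σ) {x : HA} {y : HB} (hx : x ≠ 0) (hy : y ≠ 0) (hx1 : ‖x‖ = 1)
    (hy1 : ‖y‖ = 1) :
    (((ρ ∘ segre) (Projectivization.mk ℂ x hx, Projectivization.mk ℂ y hy) : ℝ) : ℂ) =
      ⟪x ⊗ₜ[ℂ] y, σ (x ⊗ₜ[ℂ] y)⟫_ℂ := by
  rw [Function.comp_apply, GeometricQM.segre_mk hx hy,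
    h.apply_mk (tmul_ne_zero' hx hy) (by rw [TensorProduct.norm_tmul, hx1, hy1, mul_one])]

/-- The marginal `ρ_A` describes the partial trace of the density matrix. -/
lemma Describes.exists_marginalA {ρ : ℙ ℂ (HA ⊗[ℂ] HB) → ℝ}
    {σ : HA ⊗[ℂ] HB →ₗ[ℂ] HA ⊗[ℂ] HB} (h : Describes ρ σ) (hσ : IsDensityMatrix σ) :
    ∃ σA : HA →ₗ[ℂ] HA, IsDensityMatrix σA ∧ Describes (marginalA ρ) σA := by
  let a := stdOrthonormalBasis ℂ HA
  let e := stdOrthonormalBasis ℂ HB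
  let S (y : HB) : HA →ₗ[ℂ] HA ⊗[ℂ] HB := (TensorProduct.mk ℂ HA HB).flip y
  let T (x : HA) : HB →ₗ[ℂ] HA ⊗[ℂ] HB := TensorProduct.mk ℂ HA HB x
  have hS (y : HB) (x : HA) : S y x = x ⊗ₜ[ℂ] y := rfl
  have hT (x : HA) (y : HB) : T x y = x ⊗ₜ[ℂ] y := rfl
  -- The partial trace over `HB`, written as a sum of compressions and therefore positive.
  have hpos : (∑ j, LinearMap.adjoint (S (e j)) ∘ₗ σ ∘ₗ S (e j)).IsPositive :=
    LinearMap.isPositive_sum _ fun j _ => hσ.1.adjoint_conj (S (e j))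
  have hinner (x : HA) : ⟪x, (∑ j, LinearMap.adjoint (S (e j)) ∘ₗ σ ∘ₗ S (e j)) x⟫_ℂ =
      ∑ j, ⟪x ⊗ₜ[ℂ] e j, σ (x ⊗ₜ[ℂ] e j)⟫_ℂ := by
    simp only [LinearMap.sum_apply, inner_sum, LinearMap.comp_apply, LinearMap.adjoint_inner_right,
      hS]
  refine ⟨_, ⟨hpos, ?_⟩, describes_of_forall_unit fun x hx hx1 => ?_⟩
  · rw [LinearMap.trace_eq_sum_inner _ a, ← hσ.2,
      LinearMap.trace_eq_sum_inner σ (a.tensorProduct e), Fintype.sum_prod_type]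
    exact Finset.sum_congr rfl fun i _ =>
      (hinner _).trans (Finset.sum_congr rfl fun j _ => by simp)
  -- For fixed `x` the slice of `ρ ∘ Seg` is described by a positive operator, in general not of
  -- trace one, and the marginal at `[x]` is its trace.
  · have hx' : (LinearMap.adjoint (T x) ∘ₗ σ ∘ₗ T x).IsPositive := hσ.1.adjoint_conj (T x)
    have hd : Describes (fun q => (ρ ∘ segre) (Projectivization.mk ℂ x hx, q))
        (LinearMap.adjoint (T x) ∘ₗ σ ∘ₗ T x) := by
      refine describes_of_forall_unit fun y hy hy1 => ?_
      rw [h.segre_mk hx hy hx1 hy1]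
      simp only [LinearMap.comp_apply, LinearMap.adjoint_inner_right, hT]
    rw [hinner, marginalA, hd.integral hx'.1, LinearMap.trace_eq_sum_inner _ e]
    simp only [LinearMap.comp_apply, LinearMap.adjoint_inner_right, hT]

/-- The marginal `ρ_B` describes the partial trace of the density matrix. -/
lemma Describes.exists_marginalB {ρ : ℙ ℂ (HA ⊗[ℂ] HB) → ℝ}
    {σ : HA ⊗[ℂ] HB →ₗ[ℂ] HA ⊗[ℂ] HB} (h : Describes ρ σ) (hσ : IsDensityMatrix σ) :
    ∃ σB : HB →ₗ[ℂ] HB, IsDensityMatrix σB ∧ Describes (marginalB ρ) σB := by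
  let a := stdOrthonormalBasis ℂ HA
  let e := stdOrthonormalBasis ℂ HB
  let S (y : HB) : HA →ₗ[ℂ] HA ⊗[ℂ] HB := (TensorProduct.mk ℂ HA HB).flip y
  let T (x : HA) : HB →ₗ[ℂ] HA ⊗[ℂ] HB := TensorProduct.mk ℂ HA HB x
  have hS (y : HB) (x : HA) : S y x = x ⊗ₜ[ℂ] y := rfl
  have hT (x : HA) (y : HB) : T x y = x ⊗ₜ[ℂ] y := rfl
  -- Here the partial trace is over `HA`, and the slices fix `y`.
  have hpos : (∑ i, LinearMap.adjoint (T (a i)) ∘ₗ σ ∘ₗ T (a i)).IsPositive :=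
    LinearMap.isPositive_sum _ fun i _ => hσ.1.adjoint_conj (T (a i))
  have hinner (y : HB) : ⟪y, (∑ i, LinearMap.adjoint (T (a i)) ∘ₗ σ ∘ₗ T (a i)) y⟫_ℂ =
      ∑ i, ⟪a i ⊗ₜ[ℂ] y, σ (a i ⊗ₜ[ℂ] y)⟫_ℂ := by
    simp only [LinearMap.sum_apply, inner_sum, LinearMap.comp_apply, LinearMap.adjoint_inner_right,
      hT]
  refine ⟨_, ⟨hpos, ?_⟩, describes_of_forall_unit fun y hy hy1 => ?_⟩
  · rw [LinearMap.trace_eq_sum_inner _ e, ← hσ.2,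
      LinearMap.trace_eq_sum_inner σ (a.tensorProduct e), Fintype.sum_prod_type_right]
    exact Finset.sum_congr rfl fun i _ =>
      (hinner _).trans (Finset.sum_congr rfl fun j _ => by simp)
  · have hy' : (LinearMap.adjoint (S y) ∘ₗ σ ∘ₗ S y).IsPositive := hσ.1.adjoint_conj (S y)
    have hd : Describes (fun p => (ρ ∘ segre) (p, Projectivization.mk ℂ y hy))
        (LinearMap.adjoint (S y) ∘ₗ σ ∘ₗ S y) := by
      refine describes_of_forall_unit fun x hx hx1 => ?_
      rw [h.segre_mk hx hy hx1 hy1]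
      simp only [LinearMap.comp_apply, LinearMap.adjoint_inner_right, hS]
    rw [hinner, marginalB, hd.integral hy'.1, LinearMap.trace_eq_sum_inner _ a]
    simp only [LinearMap.comp_apply, LinearMap.adjoint_inner_right, hS]

lemma Describes.segre_sum {ρ : ℙ ℂ (HA ⊗[ℂ] HB) → ℝ} {ι : Type*} [Fintype ι] {w : ι → ℝ}
    {σA : ι → HA →ₗ[ℂ] HA} {σB : ι → HB →ₗ[ℂ] HB} {ρA : ι → ℙ ℂ HA → ℝ} {ρB : ι → ℙ ℂ HB → ℝ}
    (h : Describes ρ (∑ k, (w k : ℂ) • TensorProduct.map (σA k) (σB k)))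
    (hA : ∀ k, Describes (ρA k) (σA k)) (hB : ∀ k, Describes (ρB k) (σB k))
    (pA : ℙ ℂ HA) (pB : ℙ ℂ HB) :
    (ρ ∘ segre) (pA, pB) = ∑ k, w k * ρA k pA * ρB k pB := by
  obtain ⟨x, hx, hx1, rfl⟩ := exists_unit_representative pA
  obtain ⟨y, hy, hy1, rfl⟩ := exists_unit_representative pB
  have := h.segre_mk hx hy hx1 hy1
  simp only [LinearMap.sum_apply, LinearMap.smul_apply, TensorProduct.map_tmul, inner_sum,
    inner_smul_right, TensorProduct.inner_tmul, ← (hA _).apply_mk hx hx1,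
    ← (hB _).apply_mk hy hy1, ← mul_assoc] at this
  exact_mod_cast this

/-- The image of the Segre embedding suffices to recover `σ`, because product vectors determine an
operator. -/
lemma Describes.eq_sum {ρ : ℙ ℂ (HA ⊗[ℂ] HB) → ℝ} {σ : HA ⊗[ℂ] HB →ₗ[ℂ] HA ⊗[ℂ] HB}
    {ι : Type*} [Fintype ι] {w : ι → ℝ}
    {σA : ι → HA →ₗ[ℂ] HA} {σB : ι → HB →ₗ[ℂ] HB} {ρA : ι → ℙ ℂ HA → ℝ} {ρB : ι → ℙ ℂ HB → ℝ}
    (h : Describes ρ σ)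
    (hA : ∀ k, Describes (ρA k) (σA k)) (hB : ∀ k, Describes (ρB k) (σB k))
    (hρ : ∀ pA pB, (ρ ∘ segre) (pA, pB) = ∑ k, w k * ρA k pA * ρB k pB) :
    σ = ∑ k, (w k : ℂ) • TensorProduct.map (σA k) (σB k) := by
  refine eq_of_inner_tmul_eq fun x y hx1 hy1 => ?_
  have hx : x ≠ 0 := norm_ne_zero_iff.1 (by simp [hx1])
  have hy : y ≠ 0 := norm_ne_zero_iff.1 (by simp [hy1])
  rw [← h.segre_mk hx hy hx1 hy1, hρ]
  simp only [LinearMap.sum_apply, LinearMap.smul_apply, TensorProduct.map_tmul, inner_sum,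
    inner_smul_right, TensorProduct.inner_tmul, ← (hA _).apply_mk hx hx1,
    ← (hB _).apply_mk hy hy1, ← mul_assoc]
  push_cast
  rfl

end Product

end GeometricQM

end

/-! ### Separable states and product states -/

theorem proposition4 {HA HB : Type*}
    [NormedAddCommGroup HA] [InnerProductSpace ℂ HA] [FiniteDimensional ℂ HA]
    [NormedAddCommGroup HB] [InnerProductSpace ℂ HB] [FiniteDimensional ℂ HB]
    (hA : 2 < Module.finrank ℂ HA) (hB : 2 < Module.finrank ℂ HB)
    (ρ : ℙ ℂ (HA ⊗[ℂ] HB) → ℝ) (hρ : GeometricQM.IsLiouvilleDensity ρ) :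
    ((∃ σ : HA ⊗[ℂ] HB →ₗ[ℂ] HA ⊗[ℂ] HB,
        GeometricQM.IsSeparable σ ∧ GeometricQM.Describes ρ σ) ↔
      ∃ (N : ℕ) (w : Fin N → ℝ) (ρA : Fin N → ℙ ℂ HA → ℝ) (ρB : Fin N → ℙ ℂ HB → ℝ),
        (∀ k, 0 ≤ w k) ∧ ∑ k, w k = 1 ∧
        (∀ k, GeometricQM.IsLiouvilleDensity (ρA k)) ∧
        (∀ k, GeometricQM.IsLiouvilleDensity (ρB k)) ∧
        ∀ (pA : ℙ ℂ HA) (pB : ℙ ℂ HB),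
          (ρ ∘ GeometricQM.segre) (pA, pB) = ∑ k, w k * ρA k pA * ρB k pB) ∧
    ((∃ σ : HA ⊗[ℂ] HB →ₗ[ℂ] HA ⊗[ℂ] HB,
        GeometricQM.IsProductState σ ∧ GeometricQM.Describes ρ σ) ↔
      ∀ (pA : ℙ ℂ HA) (pB : ℙ ℂ HB),
        (ρ ∘ GeometricQM.segre) (pA, pB) =
          GeometricQM.marginalA ρ pA * GeometricQM.marginalB ρ pB) := by
  have hAB : 2 < finrank ℂ (HA ⊗[ℂ] HB) := by
    rw [finrank_tensorProduct]; nlinarith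
  obtain ⟨σ, hσ, hdesc⟩ := hρ.exists_describes hAB
  refine ⟨⟨?_, ?_⟩, ⟨?_, ?_⟩⟩
  · rintro ⟨_, ⟨N, w, σA, σB, hw, hw1, hσA, hσB, rfl⟩, h⟩
    exact ⟨N, w, fun k => GeometricQM.expectation (σA k), fun k => GeometricQM.expectation (σB k),
      hw, hw1, fun k => (hσA k).isLiouvilleDensity, fun k => (hσB k).isLiouvilleDensity,
      h.segre_sum (fun k => GeometricQM.describes_expectation (hσA k).1.1)
        fun k => GeometricQM.describes_expectation (hσB k).1.1⟩
  · rintro ⟨N, w, ρA, ρB, hw, hw1, hρA, hρB, h⟩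
    choose σA hσA hdA using fun k => (hρA k).exists_describes hA
    choose σB hσB hdB using fun k => (hρB k).exists_describes hB
    exact ⟨σ, ⟨N, w, σA, σB, hw, hw1, hσA, hσB, hdesc.eq_sum hdA hdB h⟩, hdesc⟩
  · rintro ⟨_, ⟨σA, σB, hσA, hσB, rfl⟩, h⟩ pA pB
    have hprod (pA : ℙ ℂ HA) (pB : ℙ ℂ HB) : (ρ ∘ GeometricQM.segre) (pA, pB) =
        GeometricQM.expectation σA pA * GeometricQM.expectation σB pB := by
      have h1 : GeometricQM.Describes ρ
          (∑ _k : Unit, ((1 : ℝ) : ℂ) • TensorProduct.map σA σB) := by simpa using h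
      simpa using h1.segre_sum (fun _ => GeometricQM.describes_expectation hσA.1.1)
        (fun _ => GeometricQM.describes_expectation hσB.1.1) pA pB
    -- Each marginal equals its own factor, since the other factor integrates to 1.
    simp only [GeometricQM.marginalA, GeometricQM.marginalB, hprod, integral_const_mul,
      integral_mul_const, hσA.isLiouvilleDensity.integral_eq_one,
      hσB.isLiouvilleDensity.integral_eq_one, mul_one, one_mul]
  · intro h
    obtain ⟨σA, hσA, hdA⟩ := hdesc.exists_marginalA hσ
    obtain ⟨σB, hσB, hdB⟩ := hdesc.exists_marginalB hσ
    refine ⟨σ, ⟨σA, σB, hσA, hσB, ?_⟩, hdesc⟩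
    -- A product is a sum with a single term of weight 1.
    simpa using hdesc.eq_sum (ι := Unit) (w := fun _ => 1) (fun _ => hdA) (fun _ => hdB)
      fun pA pB => by simpa using h pA pB
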